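/- Let $\lambda\in(0,1)$, $K=\{\mathrm{diag}(-\lambda,0),\ \mathrm{diag}(1-\lambda,0)\}\subset\mathbb R^{2\times2}$ and $K_0=K\cup\{0\}$. For $\epsilon>0$ and $\chi\in BV(\mathbb R^2;K_0)$ (that is, $\chi\in L^1$ with finite total variation and $\chi\in K_0$ almost everywhere) set $$E_\epsilon(\chi)=\inf_{u\in H^1(\mathbb R^2;\mathbb R^2)}\int_{\mathbb R^2}|\nabla u-\chi|^2\,dx+\epsilon\,|D\chi|(\mathbb R^2),$$ where $|\cdot|$ is the Euclidean (Frobenius) norm and $|D\chi|(\mathbb R^2)$ is the total variation of $\chi$. For $V>0$ let $$E_\epsilon(V)=\inf\bigl\{E_\epsilon(\chi)\;:\;\chi\in BV(\mathbb R^2;K_0),\ |\{x:\chi(x)\neq0\}|=V\bigr\},$$ with $|\cdot|$ of a set denoting Lebesgue measure. Then there exist constants $C_2>C_1>0$, depending only on $\lambda$, such that for every $V>0$ and every $\epsilon>0$ $$C_1\,r_\epsilon(V)\le E_\epsilon(V)\le C_2\,r_\epsilon(V),\qquad r_\epsilon(V)=\begin{cases}\epsilon V^{1/2}, & V\le\epsilon^2,\\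 \epsilon^{4/5}V^{3/5}, & V>\epsilon^2.\end{cases}$$ -/

import Mathlib

open MeasureTheory
open scoped ENNReal ContDiff

namespace Nucleation

/-- Euclidean space `ℝⁿ`. -/
abbrev Space (n : ℕ) : Type := EuclideanSpace ℝ (Fin n)

/-- The `k`-th partial derivative of a scalar function. -/
noncomputable def partialDeriv {n : ℕ} (k : Fin n) (f : Space n → ℝ) (x : Space n) : ℝ :=
  fderiv ℝ f x (EuclideanSpace.single k 1)

/-- `G` is the weak (distributional) gradient of the vector field `u`, i.e. `G i j = ∂ⱼ uᵢ`,
tested against smooth compactly supported functions. -/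
def IsWeakGradient {n : ℕ} (u : Space n → Space n)
    (G : Space n → Matrix (Fin n) (Fin n) ℝ) : Prop :=
  ∀ i j : Fin n, ∀ φ : Space n → ℝ, ContDiff ℝ ∞ φ → HasCompactSupport φ →
    ∫ x, u x i * partialDeriv j φ x = - ∫ x, G x i j * φ x

/-- The Sobolev space `H¹(ℝⁿ; ℝⁿ)`: a square-integrable vector field together with
(a representative of) its square-integrable weak gradient. -/
structure SobolevH1 (n : ℕ) where
  toFun : Space n → Space n
  grad : Space n → Matrix (Fin n) (Fin n) ℝ
  memLp_toFun : MemLp toFun 2 volume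
  memLp_grad : ∀ i j : Fin n, MemLp (fun x => grad x i j) 2 volume
  isWeakGradient : IsWeakGradient toFun grad

/-- Admissible test fields for the total variation of a matrix field on `ℝⁿ`: families `φ i j k` of
compactly supported `C¹` functions with pointwise Euclidean norm at most one. -/
def IsTestField {n : ℕ} (φ : Fin n → Fin n → Fin n → Space n → ℝ) : Prop :=
  (∀ i j k, ContDiff ℝ 1 (φ i j k)) ∧ (∀ i j k, HasCompactSupport (φ i j k)) ∧
    ∀ x, ∑ i, ∑ j, ∑ k, (φ i j k x) ^ 2 ≤ 1

/-- The total variation `|Dχ|(ℝⁿ)` of a matrix field, with the Euclidean norm on the values of the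
derivative; this is the surface energy. -/
noncomputable def totalVariation {n : ℕ} (χ : Space n → Matrix (Fin n) (Fin n) ℝ) : ℝ≥0∞ :=
  ⨆ (φ : Fin n → Fin n → Fin n → Space n → ℝ) (_ : IsTestField φ),
    ENNReal.ofReal (∫ x, ∑ i, ∑ j, ∑ k, χ x i j * partialDeriv k (φ i j k) x)

/-- `χ ∈ BV(ℝⁿ; K₀)` with `K₀ = K ∪ {0}`. -/
structure IsPhaseField {n : ℕ} (K : Set (Matrix (Fin n) (Fin n) ℝ))
    (χ : Space n → Matrix (Fin n) (Fin n) ℝ) : Prop where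
  integrable : ∀ i j : Fin n, Integrable (fun x => χ x i j) volume
  totalVariation_lt_top : totalVariation χ < ⊤
  mem_wells : ∀ᵐ x ∂(volume : Measure (Space n)), χ x ∈ K ∪ {0}

/-- The elastic energy `E_el(u, χ) = ∫ |∇u - χ|²` with the Frobenius norm. -/
noncomputable def elasticEnergy {n : ℕ} (u : SobolevH1 n)
    (χ : Space n → Matrix (Fin n) (Fin n) ℝ) : ℝ≥0∞ :=
  ∫⁻ x, ENNReal.ofReal (∑ i, ∑ j, (u.grad x i j - χ x i j) ^ 2)

/-- The elastic energy `E_el(χ)`, the infimum of `E_el(u, χ)` over `u ∈ H¹(ℝⁿ; ℝⁿ)`. -/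
noncomputable def relaxedElasticEnergy {n : ℕ}
    (χ : Space n → Matrix (Fin n) (Fin n) ℝ) : ℝ≥0∞ :=
  ⨅ u : SobolevH1 n, elasticEnergy u χ

/-- The total energy `E_ε(χ) = E_el(χ) + ε |Dχ|(ℝⁿ)`. -/
noncomputable def totalEnergy {n : ℕ} (ε : ℝ)
    (χ : Space n → Matrix (Fin n) (Fin n) ℝ) : ℝ≥0∞ :=
  relaxedElasticEnergy χ + ENNReal.ofReal ε * totalVariation χ

/-- The minimal energy `E_ε(V)` of an inclusion of volume `V`: the infimum of `E_ε(χ)` over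
`χ ∈ BV(ℝⁿ; K ∪ {0})` for which the set where `χ ≠ 0` has Lebesgue measure `V`. -/
noncomputable def minimalEnergy {n : ℕ} (K : Set (Matrix (Fin n) (Fin n) ℝ)) (ε V : ℝ) : ℝ≥0∞ :=
  ⨅ (χ : Space n → Matrix (Fin n) (Fin n) ℝ) (_ : IsPhaseField K χ)
    (_ : volume {x | χ x ≠ 0} = ENNReal.ofReal V), totalEnergy ε χ

/-- The two wells `diag(-l, 0)` and `diag(1 - l, 0)`. -/
def twoWells (l : ℝ) : Set (Matrix (Fin 2) (Fin 2) ℝ) :=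
  {Matrix.diagonal ![-l, 0], Matrix.diagonal ![1 - l, 0]}

/-- The scaling law `r_ε(V)`. -/
noncomputable def scalingLaw (ε V : ℝ) : ℝ :=
  if V ≤ ε ^ 2 then ε * V ^ (1 / 2 : ℝ) else ε ^ (4 / 5 : ℝ) * V ^ (3 / 5 : ℝ)

end Nucleation

/-! Write `f = χ₀₀`, `q = min l (1 - l)`, `T` for the total variation and `E` for the elastic energy
of a competitor. On the inclusion `q ≤ |f| ≤ 1`, and all other entries of `χ` vanish.

Lower bound, by duality: pair `f` with a smooth `ψ` such that `|ψ| ≤ 1`, `∫ |ψ| ≤ V` and `∫ f ψ > q²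
V / 2` (`exists_smooth_test`). Averaging `ψ` over length `a` in direction 0 costs at most `a T`. To
average next over length `b` in direction 1, pass from `f` to `∂₀u₀`. Symmetry of second derivatives
turns the change of test function into a pairing with `∂₁u₀`, which is small in `L²` because `χ₀₁ =
0`. These steps cost a multiple of `(1 + b / a) √E √V`. The resulting rectangle average of `ψ` is at
most `V / (a b)`, so it contributes at most `V² / (a b)` (`integral_mul_le_of_elastic`). Taking `a ~
V / T` and `b ~ T` gives `E T⁴ ≳ V³`; using the variation in both directions gives the isoperimetric
bound `T ≳ √V` (`integral_mul_le_of_variation`). The two regimes follow from these bounds and `(E +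
ε T)⁵ ≥ E (ε T)⁴` (`lower_bound_of_interpolation`).

Upper bound: a diamond of width `w` and length `2 L` carries a tent-shaped displacement `u₀` with
`∂₀u₀ = χ₀₀` exactly and `|∂₁u₀| ≤ w / L`. Its volume is `w L`, its elastic energy at most `w³ / L`
and its variation at most `8 L` (`minimalEnergy_le_of_tent`). The choice is `w = L = √V` for small
volumes; for large ones `w³ / L` is balanced with `ε L`. -/

namespace Nucleation

/-! ### Weighted averages along segments: regularity, derivatives, sup and `L²` bounds. -/

section SegmentAverage

variable {E F : Type} [NormedAddCommGroup E] [NormedSpace ℝ E]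
  [NormedAddCommGroup F] [NormedSpace ℝ F]

/-- The weighted average of `ψ` over the segment from `x` to `x + v`. -/
noncomputable def segAvg (w : ℝ → ℝ) (v : E) (ψ : E → F) (x : E) : F :=
  ∫ t in (0 : ℝ)..1, w t • ψ (x + t • v)

lemma continuous_segAvg_integrand {w : ℝ → ℝ} (hw : Continuous w) {ψ : E → F} (hψ : Continuous ψ)
    (v x : E) : Continuous fun t : ℝ => w t • ψ (x + t • v) := by
  fun_prop

lemma hasFDerivAt_segAvg {w : ℝ → ℝ} (hw : Continuous w) {ψ : E → F} (hψ : ContDiff ℝ 1 ψ)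
    (hc : HasCompactSupport ψ) (v x : E) :
    HasFDerivAt (segAvg w v ψ) (segAvg w v (fderiv ℝ ψ) x) x := by
  have hd : Continuous (fderiv ℝ ψ) := hψ.continuous_fderiv one_ne_zero
  obtain ⟨C, hC⟩ := hd.bounded_above_of_compact_support (hc.fderiv (𝕜 := ℝ))
  refine intervalIntegral.hasFDerivAt_integral_of_dominated_of_fderiv_le (𝕜 := ℝ)
    (F := fun y t => w t • ψ (y + t • v)) (F' := fun y t => w t • fderiv ℝ ψ (y + t • v))
    (s := Set.univ) (bound := fun t => |w t| * C) Filter.univ_mem ?_ ?_ ?_ ?_ ?_ ?_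
  · exact Filter.Eventually.of_forall fun y =>
      (continuous_segAvg_integrand hw hψ.continuous v y).aestronglyMeasurable
  · exact (continuous_segAvg_integrand hw hψ.continuous v x).intervalIntegrable _ _
  · exact (continuous_segAvg_integrand hw hd v x).aestronglyMeasurable
  · refine Filter.Eventually.of_forall fun t _ y _ => ?_
    rw [norm_smul, Real.norm_eq_abs]
    exact mul_le_mul_of_nonneg_left (hC _) (abs_nonneg _)
  · exact (by fun_prop : Continuous fun t => |w t| * C).intervalIntegrable _ _
  · refine Filter.Eventually.of_forall fun t _ y _ => ?_
    have h1 : HasFDerivAt ψ (fderiv ℝ ψ (y + t • v)) (y + t • v) :=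
      (hψ.differentiable one_ne_zero _).hasFDerivAt
    exact ((hasFDerivAt_comp_add_right (t • v)).2 h1).const_smul (w t)

lemma fderiv_segAvg {w : ℝ → ℝ} (hw : Continuous w) {ψ : E → F} (hψ : ContDiff ℝ 1 ψ)
    (hc : HasCompactSupport ψ) (v : E) :
    fderiv ℝ (segAvg w v ψ) = segAvg w v (fderiv ℝ ψ) :=
  funext fun x => (hasFDerivAt_segAvg hw hψ hc v x).fderiv

lemma hasCompactSupport_segAvg (w : ℝ → ℝ) (v : E) {ψ : E → F} (hc : HasCompactSupport ψ) :
    HasCompactSupport (segAvg w v ψ) := by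
  have hK : IsCompact ((fun p : E × ℝ => p.1 - p.2 • v) '' (tsupport ψ ×ˢ Set.Icc 0 1)) :=
    (IsCompact.prod hc isCompact_Icc).image (by fun_prop)
  refine HasCompactSupport.intro hK fun x hx => ?_
  refine intervalIntegral.integral_zero_ae (Filter.Eventually.of_forall fun t ht => ?_)
  rw [Set.uIoc_of_le zero_le_one] at ht
  have : ψ (x + t • v) = 0 := by
    by_contra h
    exact hx ⟨(x + t • v, t), ⟨subset_tsupport _ h, ht.1.le, ht.2⟩, by simp⟩
  rw [this, smul_zero]

lemma continuous_segAvg {w : ℝ → ℝ} (hw : Continuous w) (v : E) {ψ : E → F} (hψ : Continuous ψ) :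
    Continuous (segAvg w v ψ) :=
  intervalIntegral.continuous_parametric_intervalIntegral_of_continuous' (by fun_prop) 0 1

end SegmentAverage

/-- The derivative of an average is the average of the derivative, so induction on the order
applies. The target space is quantified inside the claim because each step replaces `ψ` by its
operator-valued derivative. -/
lemma contDiff_nat_segAvg {E : Type} [NormedAddCommGroup E] [NormedSpace ℝ E] {w : ℝ → ℝ}
    (hw : Continuous w) (v : E) (n : ℕ) :
    ∀ {F : Type} [NormedAddCommGroup F] [NormedSpace ℝ F] {ψ : E → F}, ContDiff ℝ n ψ →
      HasCompactSupport ψ → ContDiff ℝ n (segAvg w v ψ) := by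
  induction n with
  | zero =>
    intro F _ _ ψ hψ _
    exact contDiff_zero.2 (continuous_segAvg hw v hψ.continuous)
  | succ n ih =>
    intro F _ _ ψ hψ hc
    have h1 : ContDiff ℝ 1 ψ := hψ.of_le (by exact_mod_cast Nat.succ_le_succ n.zero_le)
    push_cast at hψ ⊢
    rw [contDiff_succ_iff_fderiv] at hψ ⊢
    refine ⟨fun x => (hasFDerivAt_segAvg hw h1 hc v x).differentiableAt, by simp, ?_⟩
    rw [fderiv_segAvg hw h1 hc v]
    exact ih hψ.2.2 (hc.fderiv (𝕜 := ℝ))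

section SegmentAverageReal

variable {E : Type} [NormedAddCommGroup E] [NormedSpace ℝ E] {ψ : E → ℝ}

lemma contDiff_segAvg {w : ℝ → ℝ} (hw : Continuous w) (v : E) (hψ : ContDiff ℝ ∞ ψ)
    (hc : HasCompactSupport ψ) : ContDiff ℝ ∞ (segAvg w v ψ) :=
  contDiff_infty.2 fun n => contDiff_nat_segAvg hw v n (contDiff_infty.1 hψ n) hc

lemma fderiv_segAvg_apply {w : ℝ → ℝ} (hw : Continuous w) (hψ : ContDiff ℝ 1 ψ)
    (hc : HasCompactSupport ψ) (v x y : E) :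
    fderiv ℝ (segAvg w v ψ) x y = segAvg w v (fun z => fderiv ℝ ψ z y) x := by
  rw [fderiv_segAvg hw hψ hc v]
  have hi : IntervalIntegrable (fun t : ℝ => w t • fderiv ℝ ψ (x + t • v)) volume 0 1 :=
    (continuous_segAvg_integrand hw (hψ.continuous_fderiv one_ne_zero) v x).intervalIntegrable _ _
  exact ContinuousLinearMap.intervalIntegral_apply hi y

lemma hasDerivAt_comp_segment (hψ : ContDiff ℝ 1 ψ) (v x : E) (t : ℝ) :
    HasDerivAt (fun s : ℝ => ψ (x + s • v)) (fderiv ℝ ψ (x + t • v) v) t := by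
  have h1 : HasFDerivAt ψ (fderiv ℝ ψ (x + t • v)) (x + t • v) :=
    (hψ.differentiable one_ne_zero _).hasFDerivAt
  have h2 : HasDerivAt (fun s : ℝ => x + s • v) v t := by
    simpa using ((hasDerivAt_id t).smul_const v).const_add x
  exact h1.comp_hasDerivAt t h2

/-- Fundamental theorem of calculus along the segment. A derivative of an averaged function thus
costs only the inverse length of `v`. -/
lemma fderiv_segAvg_one_apply_self (hψ : ContDiff ℝ 1 ψ) (hc : HasCompactSupport ψ) (v x : E) :
    fderiv ℝ (segAvg (fun _ => 1) v ψ) x v = ψ (x + v) - ψ x := by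
  have hd : Continuous (fun z => fderiv ℝ ψ z v) :=
    (hψ.continuous_fderiv one_ne_zero).clm_apply continuous_const
  rw [fderiv_segAvg_apply continuous_const hψ hc]
  have := intervalIntegral.integral_eq_sub_of_hasDerivAt (a := 0) (b := 1)
    (fun t _ => hasDerivAt_comp_segment hψ v x t)
    ((by fun_prop : Continuous fun t : ℝ => fderiv ℝ ψ (x + t • v) v).intervalIntegrable _ _)
  simpa [segAvg] using this

/-- Integration by parts in `t`: the weight `1 - t` vanishes at the far end and has slope `-1`. The
error of replacing `ψ` by its mean is thereby a directional derivative of a function no larger than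
`ψ`. -/
lemma fderiv_segAvg_linear_apply_self (hψ : ContDiff ℝ 1 ψ) (hc : HasCompactSupport ψ) (v x : E) :
    fderiv ℝ (segAvg (fun t => 1 - t) v ψ) x v = segAvg (fun _ => 1) v ψ x - ψ x := by
  have hd : Continuous (fun z => fderiv ℝ ψ z v) :=
    (hψ.continuous_fderiv one_ne_zero).clm_apply continuous_const
  have hcψ := hψ.continuous
  rw [fderiv_segAvg_apply (by fun_prop) hψ hc]
  have := intervalIntegral.integral_eq_sub_of_hasDerivAt (a := 0) (b := 1)
    (f := fun t : ℝ => (1 - t) * ψ (x + t • v))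
    (fun t _ => ((hasDerivAt_id t).const_sub 1).mul (hasDerivAt_comp_segment hψ v x t))
    ((by simp only [id]; fun_prop : Continuous fun t : ℝ => -1 * ψ (x + t • v) +
      (1 - id t) * fderiv ℝ ψ (x + t • v) v).intervalIntegrable _ _)
  rw [intervalIntegral.integral_add
    ((by fun_prop : Continuous fun t : ℝ => -1 * ψ (x + t • v)).intervalIntegrable _ _)
    ((by simp only [id]; fun_prop : Continuous fun t : ℝ =>
      (1 - id t) * fderiv ℝ ψ (x + t • v) v).intervalIntegrable _ _)] at this
  simp [segAvg] at this ⊢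
  linarith

lemma abs_segAvg_le {w : ℝ → ℝ} (hw : ∀ t ∈ Set.Icc (0 : ℝ) 1, |w t| ≤ 1) {M : ℝ}
    (hM : ∀ x, |ψ x| ≤ M) (v x : E) : |segAvg w v ψ x| ≤ M := by
  have := intervalIntegral.norm_integral_le_of_norm_le_const (a := 0) (b := 1) (C := M)
    (f := fun t : ℝ => w t • ψ (x + t • v)) fun t ht => by
      rw [Set.uIoc_of_le zero_le_one] at ht
      rw [norm_smul, Real.norm_eq_abs, Real.norm_eq_abs]
      calc |w t| * |ψ (x + t • v)| ≤ 1 * M :=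
            mul_le_mul (hw t ⟨ht.1.le, ht.2⟩) (hM _) (abs_nonneg _) zero_le_one
        _ = M := one_mul M
  simpa [segAvg] using this

lemma segAvg_sq_le {w : ℝ → ℝ} (hwc : Continuous w) (hw : ∀ t ∈ Set.Icc (0 : ℝ) 1, |w t| ≤ 1)
    (hψ : Continuous ψ) (v x : E) :
    segAvg w v ψ x ^ 2 ≤ ∫ t in (0 : ℝ)..1, ψ (x + t • v) ^ 2 := by
  set g : ℝ → ℝ := fun t => w t * ψ (x + t • v) with hg
  have hgc : Continuous g := by fun_prop
  set c : ℝ := ∫ t in (0 : ℝ)..1, g t with hcdef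
  -- Jensen's inequality, in the form that a variance is nonnegative.
  have h0 : 0 ≤ ∫ t in (0 : ℝ)..1, (g t - c) ^ 2 :=
    intervalIntegral.integral_nonneg zero_le_one fun t _ => sq_nonneg _
  have h1 : ∫ t in (0 : ℝ)..1, (g t - c) ^ 2 = (∫ t in (0 : ℝ)..1, g t ^ 2) - c ^ 2 := by
    have : ∀ t, (g t - c) ^ 2 = g t ^ 2 - (2 * c * g t - c ^ 2) := fun t => by ring
    simp_rw [this]
    rw [intervalIntegral.integral_sub, intervalIntegral.integral_sub,
      intervalIntegral.integral_const_mul, ← hcdef]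
    · simp; ring
    all_goals exact (by fun_prop : Continuous _).intervalIntegrable _ _
  have h2 : ∫ t in (0 : ℝ)..1, g t ^ 2 ≤ ∫ t in (0 : ℝ)..1, ψ (x + t • v) ^ 2 := by
    refine intervalIntegral.integral_mono_on zero_le_one
      ((by fun_prop : Continuous fun t => g t ^ 2).intervalIntegrable _ _)
      ((by fun_prop : Continuous fun t : ℝ => ψ (x + t • v) ^ 2).intervalIntegrable _ _)
      fun t ht => ?_
    have : w t ^ 2 ≤ 1 := (sq_le_one_iff_abs_le_one _).2 (hw t ht)
    rw [hg]
    simp only [mul_pow]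
    exact mul_le_of_le_one_left (sq_nonneg _) this
  change c ^ 2 ≤ _
  linarith


lemma ofReal_segAvg_sq_le {w : ℝ → ℝ} (hwc : Continuous w)
    (hw : ∀ t ∈ Set.Icc (0 : ℝ) 1, |w t| ≤ 1) (hψ : Continuous ψ) (v x : E) :
    ENNReal.ofReal (segAvg w v ψ x ^ 2)
      ≤ ∫⁻ t in Set.Ioc (0 : ℝ) 1, ENNReal.ofReal (ψ (x + t • v) ^ 2) := by
  have hi : Continuous fun t : ℝ => ψ (x + t • v) ^ 2 := by fun_prop
  rw [← ofReal_integral_eq_lintegral_ofReal hi.integrableOn_Ioc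
    (Filter.Eventually.of_forall fun t => sq_nonneg _),
    ← intervalIntegral.integral_of_le zero_le_one]
  exact ENNReal.ofReal_le_ofReal (segAvg_sq_le hwc hw hψ v x)

end SegmentAverageReal

lemma integrable_sq_of_hasCompactSupport {E : Type} [TopologicalSpace E] [T2Space E]
    [MeasurableSpace E] [BorelSpace E] {ψ : E → ℝ} (μ : Measure E)
    [IsFiniteMeasureOnCompacts μ] (hψ : Continuous ψ) (hc : HasCompactSupport ψ) :
    Integrable (fun x => ψ x ^ 2) μ := by
  refine Continuous.integrable_of_hasCompactSupport (by fun_prop) ?_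
  simp_rw [pow_two]
  exact hc.mul_right

section SegmentAverageIntegral

variable {E : Type} [NormedAddCommGroup E] [NormedSpace ℝ E] {ψ : E → ℝ}
  [MeasurableSpace E] [BorelSpace E] [FiniteDimensional ℝ E]
  (μ : Measure E) [μ.IsAddHaarMeasure]

/-- Tonelli and translation invariance: every `t` contributes the same integral, over a parameter
interval of length one. -/
lemma lintegral_segment_sq (hψ : Continuous ψ) (v : E) :
    ∫⁻ x, ∫⁻ t in Set.Ioc (0 : ℝ) 1, (ENNReal.ofReal (ψ (x + t • v) ^ 2)) ∂volume ∂μ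
      = ∫⁻ x, ENNReal.ofReal (ψ x ^ 2) ∂μ := by
  have hm : Continuous fun p : E × ℝ => ENNReal.ofReal (ψ (p.1 + p.2 • v) ^ 2) :=
    ENNReal.continuous_ofReal.comp (by fun_prop)
  rw [lintegral_lintegral_swap hm.measurable.aemeasurable]
  have : ∀ t : ℝ, ∫⁻ x, ENNReal.ofReal (ψ (x + t • v) ^ 2) ∂μ
      = ∫⁻ x, ENNReal.ofReal (ψ x ^ 2) ∂μ := fun t =>
    lintegral_add_right_eq_self (fun x => ENNReal.ofReal (ψ x ^ 2)) (t • v)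
  simp only [this]
  simp

lemma integral_segAvg_sq_le {w : ℝ → ℝ} (hwc : Continuous w)
    (hw : ∀ t ∈ Set.Icc (0 : ℝ) 1, |w t| ≤ 1)
    (hψ : Continuous ψ) (hc : HasCompactSupport ψ) (v : E) :
    ∫ x, segAvg w v ψ x ^ 2 ∂μ ≤ ∫ x, ψ x ^ 2 ∂μ := by
  have h1 := integrable_sq_of_hasCompactSupport μ hψ hc
  have h2 := integrable_sq_of_hasCompactSupport μ (continuous_segAvg hwc v hψ)
    (hasCompactSupport_segAvg w v hc)
  have h3 := (lintegral_mono (μ := μ) fun x => ofReal_segAvg_sq_le hwc hw hψ v x).trans_eq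
    (lintegral_segment_sq μ hψ v)
  rw [← ofReal_integral_eq_lintegral_ofReal h1 (Filter.Eventually.of_forall fun x => sq_nonneg _),
    ← ofReal_integral_eq_lintegral_ofReal h2
      (Filter.Eventually.of_forall fun x => sq_nonneg _)] at h3
  exact (ENNReal.ofReal_le_ofReal_iff (integral_nonneg fun x => sq_nonneg _)).1 h3

end SegmentAverageIntegral

/-! ### Planar Fubini and the sup bound for rectangle averages. -/

/-- Cartesian coordinates on the plane. -/
noncomputable def planeEquiv : ℝ × ℝ ≃ᵐ Space 2 :=
  MeasurableEquiv.finTwoArrow.symm.trans (MeasurableEquiv.toLp 2 (Fin 2 → ℝ))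

lemma measurePreserving_planeEquiv : MeasurePreserving planeEquiv :=
  ((volume_preserving_finTwoArrow ℝ).symm).trans (PiLp.volume_preserving_toLp (Fin 2))

lemma lintegral_plane {g : Space 2 → ℝ≥0∞} (hg : Measurable g) :
    ∫⁻ x, g x = ∫⁻ s : ℝ, ∫⁻ t : ℝ, g !₂[s, t] := by
  rw [← measurePreserving_planeEquiv.lintegral_comp hg, Measure.volume_eq_prod,
    lintegral_prod (fun p => g (planeEquiv p)) (hg.comp planeEquiv.measurable).aemeasurable]
  rfl

lemma integral_plane {g : Space 2 → ℝ} (hg : Integrable g) :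
    ∫ x, g x = ∫ s : ℝ, ∫ t : ℝ, g !₂[s, t] := by
  rw [← measurePreserving_planeEquiv.integral_comp', Measure.volume_eq_prod, integral_prod]
  · rfl
  · exact (measurePreserving_planeEquiv.integrable_comp_emb planeEquiv.measurableEmbedding).2 hg

lemma lintegral_comp_add_mul {a : ℝ} (ha : 0 < a) (c : ℝ) {g : ℝ → ℝ≥0∞} (hg : Measurable g) :
    ∫⁻ s, g (c + s * a) = ENNReal.ofReal a⁻¹ * ∫⁻ s, g s := by
  rw [← lintegral_add_left_eq_self g c]
  have h := lintegral_map (μ := volume) (f := fun s => g (c + s)) (g := fun s : ℝ => s * a)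
    (by fun_prop) (by fun_prop)
  rw [Real.map_volume_mul_right ha.ne', lintegral_smul_measure, abs_of_pos (inv_pos.2 ha)] at h
  exact h.symm

/-- The iterated average is the mean of `ψ` over an `a` by `b` rectangle with corner `x`; enlarging
the rectangle to the plane leaves the inverse area times the `L¹` norm. -/
lemma abs_segAvg_segAvg_le {ψ : Space 2 → ℝ} (hψ : Continuous ψ) (hc : HasCompactSupport ψ)
    {a b : ℝ} (ha : 0 < a) (hb : 0 < b) (x : Space 2) :
    |segAvg (fun _ => 1) (EuclideanSpace.single 1 b)
        (segAvg (fun _ => 1) (EuclideanSpace.single 0 a) ψ) x|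
      ≤ (a * b)⁻¹ * ∫ y, |ψ y| := by
  have hm : Measurable fun y => ‖ψ y‖ₑ := by fun_prop
  have hmp : Measurable fun p : ℝ × ℝ => ‖ψ !₂[p.1, p.2]‖ₑ := hm.comp planeEquiv.measurable
  have hpt : ∀ s t : ℝ, x + t • EuclideanSpace.single (1 : Fin 2) b
      + s • EuclideanSpace.single (0 : Fin 2) a = !₂[x 0 + s * a, x 1 + t * b] := by
    intro s t
    ext i
    fin_cases i <;> simp
  have key : ‖segAvg (fun _ => 1) (EuclideanSpace.single 1 b)
        (segAvg (fun _ => 1) (EuclideanSpace.single 0 a) ψ) x‖ₑ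
      ≤ ENNReal.ofReal ((a * b)⁻¹) * ∫⁻ y, ‖ψ y‖ₑ := by
    simp only [segAvg, one_smul, hpt, intervalIntegral.integral_of_le zero_le_one]
    calc _ ≤ ∫⁻ t in Set.Ioc (0 : ℝ) 1, ∫⁻ s in Set.Ioc (0 : ℝ) 1,
            ‖ψ !₂[x 0 + s * a, x 1 + t * b]‖ₑ := by
          refine (enorm_integral_le_lintegral_enorm _).trans (lintegral_mono fun t => ?_)
          exact enorm_integral_le_lintegral_enorm _
      _ ≤ ∫⁻ t, ∫⁻ s, ‖ψ !₂[x 0 + s * a, x 1 + t * b]‖ₑ :=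
          (setLIntegral_le_lintegral _ _).trans
            (lintegral_mono fun t => setLIntegral_le_lintegral _ _)
      _ = ∫⁻ t, ENNReal.ofReal a⁻¹ * ∫⁻ s, ‖ψ !₂[s, x 1 + t * b]‖ₑ := by
          refine lintegral_congr fun t => ?_
          exact lintegral_comp_add_mul ha (x 0) (g := fun s => ‖ψ !₂[s, x 1 + t * b]‖ₑ)
            (hmp.comp (measurable_id.prodMk measurable_const))
      _ = ENNReal.ofReal ((a * b)⁻¹) * ∫⁻ y, ‖ψ y‖ₑ := by
          have hmr : Measurable fun t : ℝ => ∫⁻ s, ‖ψ !₂[s, t]‖ₑ := hmp.lintegral_prod_left'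
          rw [lintegral_const_mul (f := fun t => ∫⁻ s, ‖ψ !₂[s, x 1 + t * b]‖ₑ) _
              (hmr.comp (by fun_prop : Measurable fun t : ℝ => x 1 + t * b)),
            lintegral_comp_add_mul hb (x 1) (g := fun t => ∫⁻ s, ‖ψ !₂[s, t]‖ₑ) hmr,
            lintegral_plane hm, lintegral_lintegral_swap (f := fun s t => ‖ψ !₂[s, t]‖ₑ) hmp.aemeasurable,
            ← mul_assoc,
            ← ENNReal.ofReal_mul (inv_nonneg.2 ha.le), mul_inv]
  rw [← ofReal_integral_norm_eq_lintegral_enorm (hψ.integrable_of_hasCompactSupport hc),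
    ← ENNReal.ofReal_mul (by positivity), ← ofReal_norm] at key
  exact (ENNReal.ofReal_le_ofReal_iff
    (mul_nonneg (by positivity) (integral_nonneg fun y => norm_nonneg _))).1 key

/-! ### Smooth test functions by mollification. -/

section Mollification

open scoped Convolution
open Filter Topology

variable {E : Type} [NormedAddCommGroup E] [NormedSpace ℝ E] [FiniteDimensional ℝ E]
  [MeasurableSpace E] [BorelSpace E] {μ : Measure E} [μ.IsAddHaarMeasure]

lemma abs_mollify_le (φ : ContDiffBump (0 : E)) {g : E → ℝ} {M : ℝ}
    (hM : ∀ᵐ x ∂μ, |g x| ≤ M) (x : E) :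
    |(φ.normed μ ⋆[ContinuousLinearMap.lsmul ℝ ℝ, μ] g) x| ≤ M := by
  have h1 : ∀ᵐ t ∂μ, ‖ContinuousLinearMap.lsmul ℝ ℝ (φ.normed μ t) (g (x - t))‖
      ≤ φ.normed μ t * M := by
    have := (quasiMeasurePreserving_sub_left_of_right_invariant μ x).ae hM
    filter_upwards [this] with t ht
    rw [ContinuousLinearMap.lsmul_apply, norm_smul, Real.norm_of_nonneg (φ.nonneg_normed t)]
    exact mul_le_mul_of_nonneg_left ht (φ.nonneg_normed t)
  have h2 := norm_integral_le_of_norm_le (φ.integrable_normed.mul_const M) h1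
  rwa [integral_mul_const, φ.integral_normed, one_mul] at h2

lemma integral_abs_mollify_le (φ : ContDiffBump (0 : E)) {g : E → ℝ} (hg : Integrable g μ) :
    ∫ x, |(φ.normed μ ⋆[ContinuousLinearMap.lsmul ℝ ℝ, μ] g) x| ∂μ ≤ ∫ x, |g x| ∂μ := by
  have h1 : Integrable (φ.normed μ ⋆[ContinuousLinearMap.lsmul ℝ ℝ, μ] fun x => |g x|) μ :=
    φ.integrable_normed.integrable_convolution _ hg.abs
  have h2 : Integrable (φ.normed μ ⋆[ContinuousLinearMap.lsmul ℝ ℝ, μ] g) μ :=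
    φ.integrable_normed.integrable_convolution _ hg
  have h3 : ∫ x, (φ.normed μ ⋆[ContinuousLinearMap.lsmul ℝ ℝ, μ] fun x => |g x|) x ∂μ
      = ContinuousLinearMap.lsmul ℝ ℝ (∫ x, φ.normed μ x ∂μ) (∫ x, |g x| ∂μ) :=
    integral_convolution _ φ.integrable_normed hg.abs
  simp only [φ.integral_normed, ContinuousLinearMap.lsmul_apply, one_smul] at h3
  rw [← h3]
  refine integral_mono h2.abs h1 fun x => ?_
  rw [convolution_def, convolution_def]
  simp only [ContinuousLinearMap.lsmul_apply, smul_eq_mul]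
  refine (norm_integral_le_integral_norm fun t => φ.normed μ t * g (x - t)).trans_eq
    (integral_congr_ae ?_)
  filter_upwards with t
  rw [norm_mul, Real.norm_of_nonneg (φ.nonneg_normed t), Real.norm_eq_abs]

/-- A bounded integrable function can be tested against smooth functions with the same bounds. -/
lemma exists_smooth_test {f : E → ℝ} (hf : Integrable f μ) (hb : ∀ᵐ x ∂μ, |f x| ≤ 1) {c : ℝ}
    (hc : c < ∫ x, f x ^ 2 ∂μ) :
    ∃ ψ : E → ℝ, ContDiff ℝ ∞ ψ ∧ HasCompactSupport ψ ∧ (∀ x, |ψ x| ≤ 1) ∧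
      ∫ x, |ψ x| ∂μ ≤ ∫ x, |f x| ∂μ ∧ c < ∫ x, f x * ψ x ∂μ := by
  have hf2 : Integrable (fun x => f x ^ 2) μ := by
    simp_rw [pow_two]
    exact hf.bdd_mul hf.aestronglyMeasurable (c := 1) hb
  have hlim : Tendsto (fun n : ℕ => ∫ x in Metric.closedBall (0 : E) n, f x ^ 2 ∂μ) atTop
      (𝓝 (∫ x, f x ^ 2 ∂μ)) := by
    have h := tendsto_setIntegral_of_monotone (μ := μ) (f := fun x => f x ^ 2)
      (s := fun n : ℕ => Metric.closedBall (0 : E) n) (fun n => Metric.isClosed_closedBall.measurableSet)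
      (fun m n hmn => Metric.closedBall_subset_closedBall (by exact_mod_cast hmn))
      hf2.integrableOn
    rwa [Metric.iUnion_closedBall_nat, setIntegral_univ] at h
  obtain ⟨N, hN⟩ := (hlim.eventually (lt_mem_nhds hc)).exists
  set s := Metric.closedBall (0 : E) N with hs
  have hsm : MeasurableSet s := Metric.isClosed_closedBall.measurableSet
  set g : E → ℝ := s.indicator f with hg
  have hgi : Integrable g μ := hf.indicator hsm
  have hgle : ∀ x, |g x| ≤ |f x| := fun x => norm_indicator_le_norm_self f x
  have hgb : ∀ᵐ x ∂μ, |g x| ≤ 1 := hb.mono fun x hx => (hgle x).trans hx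
  have hgc : HasCompactSupport g :=
    HasCompactSupport.intro (isCompact_closedBall (0 : E) N) fun x hx => Set.indicator_of_notMem hx f
  -- The fixed ratio 2 of the radii is what the almost everywhere convergence of the mollifications
  -- requires.
  let φ : ℕ → ContDiffBump (0 : E) := fun n =>
    { rIn := 1 / ((n : ℝ) + 1), rOut := 2 * (1 / ((n : ℝ) + 1)), rIn_pos := by positivity
      rIn_lt_rOut := by
        have : 0 < 1 / ((n : ℝ) + 1) := by positivity
        linarith }
  set ψ : ℕ → E → ℝ := fun n => (φ n).normed μ ⋆[ContinuousLinearMap.lsmul ℝ ℝ, μ] g with hψ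
  have hφ0 : Tendsto (fun n => (φ n).rOut) atTop (𝓝 0) := by
    have h := (tendsto_one_div_add_atTop_nhds_zero_nat (𝕜 := ℝ)).const_mul 2
    rwa [mul_zero] at h
  have hae := ContDiffBump.ae_convolution_tendsto_right_of_locallyIntegrable (μ := μ) (K := 2) hφ0
    (Eventually.of_forall fun n => le_rfl) hgi.locallyIntegrable
  have hψs : ∀ n, ContDiff ℝ ∞ (ψ n) := fun n =>
    (φ n).hasCompactSupport_normed.contDiff_convolution_left _ (φ n).contDiff_normed
      hgi.locallyIntegrable
  have hψ1 : ∀ n x, |ψ n x| ≤ 1 := fun n x => abs_mollify_le (φ n) hgb x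
  -- Since `|ψ n| ≤ 1`, the function `|f|` dominates; the limit is the integral of `f²` over the
  -- ball, which already exceeds `c`.
  have hconv : Tendsto (fun n => ∫ x, f x * ψ n x ∂μ) atTop (𝓝 (∫ x, f x * g x ∂μ)) := by
    refine tendsto_integral_of_dominated_convergence (fun x => |f x|)
      (fun n => hf.aestronglyMeasurable.mul (hψs n).continuous.aestronglyMeasurable) hf.abs
      (fun n => Eventually.of_forall fun x => ?_) ?_
    · rw [norm_mul, Real.norm_eq_abs, Real.norm_eq_abs]
      exact mul_le_of_le_one_right (abs_nonneg _) (hψ1 n x)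
    · filter_upwards [hae] with x hx
      exact hx.const_mul (f x)
  have hfg : ∫ x, f x * g x ∂μ = ∫ x in s, f x ^ 2 ∂μ := by
    rw [← integral_indicator hsm]
    refine integral_congr_ae (Eventually.of_forall fun x => ?_)
    by_cases hx : x ∈ s <;> simp [hg, hx, pow_two]
  rw [hfg] at hconv
  obtain ⟨n, hn⟩ := (hconv.eventually (lt_mem_nhds hN)).exists
  refine ⟨ψ n, hψs n, ?_, hψ1 n, ?_, hn⟩
  · exact HasCompactSupport.convolution _ (φ n).hasCompactSupport_normed hgc
  · exact (integral_abs_mollify_le (φ n) hgi).trans (integral_mono hgi.abs hf.abs hgle)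

end Mollification

/-! ### Partial derivatives and the curl-free property of weak gradients. -/

section PartialDerivatives

variable {n : ℕ}

lemma fderiv_single (k : Fin n) (a : ℝ) (f : Space n → ℝ) (x : Space n) :
    fderiv ℝ f x (EuclideanSpace.single k a) = a * partialDeriv k f x := by
  have : EuclideanSpace.single k a = a • (EuclideanSpace.single k (1 : ℝ) : Space n) := by
    ext i
    by_cases h : i = k <;> simp [h]
  rw [this, map_smul, smul_eq_mul, partialDeriv]

lemma contDiff_partialDeriv (k : Fin n) {f : Space n → ℝ} (hf : ContDiff ℝ ∞ f) :
    ContDiff ℝ ∞ (partialDeriv k f) :=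
  (hf.fderiv_right (by simp)).clm_apply contDiff_const

lemma continuous_partialDeriv (k : Fin n) {f : Space n → ℝ} (hf : ContDiff ℝ 1 f) :
    Continuous (partialDeriv k f) :=
  (hf.continuous_fderiv one_ne_zero).clm_apply continuous_const

lemma hasCompactSupport_partialDeriv (k : Fin n) {f : Space n → ℝ} (hf : HasCompactSupport f) :
    HasCompactSupport (partialDeriv k f) :=
  hf.fderiv_apply (𝕜 := ℝ) _

lemma partialDeriv_neg (k : Fin n) (f : Space n → ℝ) (x : Space n) :
    partialDeriv k (fun y => -f y) x = -partialDeriv k f x := by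
  simp [partialDeriv]

lemma partialDeriv_comm (j k : Fin n) {f : Space n → ℝ} (hf : ContDiff ℝ ∞ f) (x : Space n) :
    partialDeriv j (partialDeriv k f) x = partialDeriv k (partialDeriv j f) x := by
  have hd : DifferentiableAt ℝ (fderiv ℝ f) x :=
    ((hf.fderiv_right (m := ∞) (by simp)).differentiable (by simp)) x
  have h : ∀ v w : Space n, fderiv ℝ (fun y => fderiv ℝ f y v) x w = fderiv ℝ (fderiv ℝ f) x w v := by
    intro v w
    rw [fderiv_clm_apply hd (differentiableAt_const v)]
    simp
  have hs : IsSymmSndFDerivAt ℝ f x :=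
    hf.contDiffAt.isSymmSndFDerivAt (by
      rw [minSmoothness_of_isRCLikeNormedField]
      exact WithTop.coe_le_coe.2 le_top)
  unfold partialDeriv
  rw [h, h]
  exact hs _ _

/-- Both sides equal `-∫ uᵢ ∂ⱼ∂ₖΨ`. This is the only way compatibility of the gradient enters the
lower bound. -/
lemma IsWeakGradient.integral_mul_partialDeriv_comm {u : Space n → Space n}
    {G : Space n → Matrix (Fin n) (Fin n) ℝ} (h : IsWeakGradient u G) (i j k : Fin n)
    {Ψ : Space n → ℝ} (hΨ : ContDiff ℝ ∞ Ψ) (hc : HasCompactSupport Ψ) :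
    ∫ x, G x i j * partialDeriv k Ψ x = ∫ x, G x i k * partialDeriv j Ψ x := by
  have h1 := h i j _ (contDiff_partialDeriv k hΨ) (hasCompactSupport_partialDeriv k hc)
  have h2 := h i k _ (contDiff_partialDeriv j hΨ) (hasCompactSupport_partialDeriv j hc)
  simp_rw [partialDeriv_comm j k hΨ] at h1
  linarith

end PartialDerivatives

lemma integral_mul_le_sqrt_mul_sqrt {α : Type*} [MeasurableSpace α] {μ : Measure α} {f g : α → ℝ}
    (hf : MemLp f 2 μ) (hg : MemLp g 2 μ) :
    ∫ x, f x * g x ∂μ ≤ √(∫ x, f x ^ 2 ∂μ) * √(∫ x, g x ^ 2 ∂μ) := by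
  have h2 : ENNReal.ofReal 2 = 2 := by norm_num
  have h := integral_mul_norm_le_Lp_mul_Lq (μ := μ) Real.HolderConjugate.two_two
    (f := f) (g := g) (by rwa [h2]) (by rwa [h2])
  have hle : ∫ x, f x * g x ∂μ ≤ ∫ x, ‖f x‖ * ‖g x‖ ∂μ := by
    refine (Real.le_norm_self _).trans ((norm_integral_le_integral_norm _).trans_eq ?_)
    simp_rw [norm_mul]
  refine hle.trans (h.trans_eq ?_)
  simp only [Real.rpow_two, Real.norm_eq_abs, sq_abs, Real.sqrt_eq_rpow]

/-- Test the variation with the field whose only nonzero entry is `Φ`, in position `(0, 0, k)`. -/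
lemma integral_mul_partialDeriv_le_totalVariation {χ : Space 2 → Matrix (Fin 2) (Fin 2) ℝ}
    (hχ : totalVariation χ < ⊤) (k : Fin 2) {Φ : Space 2 → ℝ} (hΦ : ContDiff ℝ 1 Φ)
    (hc : HasCompactSupport Φ) (hb : ∀ x, |Φ x| ≤ 1) :
    ∫ x, χ x 0 0 * partialDeriv k Φ x ≤ (totalVariation χ).toReal := by
  set φ : Fin 2 → Fin 2 → Fin 2 → Space 2 → ℝ :=
    fun i j m => if i = 0 ∧ j = 0 ∧ m = k then Φ else fun _ => 0 with hφ
  have hz : ∀ m x, partialDeriv m (fun _ : Space 2 => (0 : ℝ)) x = 0 := by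
    intro m x
    simp [partialDeriv]
  have ht : IsTestField φ := by
    refine ⟨fun i j m => ?_, fun i j m => ?_, fun x => ?_⟩
    · simp only [hφ]
      split_ifs
      exacts [hΦ, contDiff_const]
    · simp only [hφ]
      split_ifs
      exacts [hc, HasCompactSupport.zero]
    · have h1 : Φ x ^ 2 ≤ 1 := (sq_le_one_iff_abs_le_one _).2 (hb x)
      fin_cases k <;> simpa [hφ, Fin.sum_univ_two] using h1
  have h1 : ENNReal.ofReal (∫ x, ∑ i, ∑ j, ∑ m, χ x i j * partialDeriv m (φ i j m) x)
      ≤ totalVariation χ := le_iSup₂_of_le φ ht le_rfl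
  have h2 : ∀ x, ∑ i, ∑ j, ∑ m, χ x i j * partialDeriv m (φ i j m) x
      = χ x 0 0 * partialDeriv k Φ x := by
    intro x
    fin_cases k <;> simp [hφ, Fin.sum_univ_two, hz]
  simp_rw [h2] at h1
  exact (ENNReal.ofReal_le_iff_le_toReal hχ.ne).1 h1

/-! ### Interpolation inequalities for the lower bound. -/

section NucleationInequalities

variable {f ψ : Space 2 → ℝ} {T : ℝ}

/-- The difference between `ψ` and its mean over length `a` is `a` times a `k`-th partial derivative
of a function bounded by one, so pairing it with `f` costs at most `a T`. -/
lemma integral_mul_le_add_segAvg (hf : Integrable f)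
    (hT : ∀ (k : Fin 2) (Φ : Space 2 → ℝ), ContDiff ℝ 1 Φ → HasCompactSupport Φ →
      (∀ x, |Φ x| ≤ 1) → ∫ x, f x * partialDeriv k Φ x ≤ T)
    (hψ : ContDiff ℝ ∞ ψ) (hc : HasCompactSupport ψ) (hb : ∀ x, |ψ x| ≤ 1) (k : Fin 2)
    {a : ℝ} (ha : 0 < a) :
    ∫ x, f x * ψ x ≤ (∫ x, f x * segAvg (fun _ => 1) (EuclideanSpace.single k a) ψ x) + a * T := by
  have hψ1 : ContDiff ℝ 1 ψ := hψ.of_le (by simp)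
  have hw : Continuous fun t : ℝ => 1 - t := by fun_prop
  set B := segAvg (fun t => 1 - t) (EuclideanSpace.single k a) ψ with hB
  set A := segAvg (fun _ => 1) (EuclideanSpace.single k a) ψ with hA
  have hBs : ContDiff ℝ 1 (fun x => -B x) :=
    ((contDiff_segAvg hw _ hψ hc).of_le (by simp)).neg
  have hBc : HasCompactSupport (fun x => -B x) := (hasCompactSupport_segAvg _ _ hc).neg
  have hBb : ∀ x, |-B x| ≤ 1 := fun x => by
    rw [abs_neg]
    exact abs_segAvg_le (fun t ht => abs_le.2 ⟨by linarith [ht.2], by linarith [ht.1]⟩) hb _ x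
  have hid : ∀ x, ψ x = A x + a * partialDeriv k (fun y => -B y) x := by
    intro x
    have := fderiv_segAvg_linear_apply_self hψ1 hc (EuclideanSpace.single k a) x
    rw [fderiv_single, ← hB, ← hA] at this
    rw [partialDeriv_neg]
    linarith
  obtain ⟨C, hC⟩ := (continuous_partialDeriv k hBs).bounded_above_of_compact_support
    (hasCompactSupport_partialDeriv k hBc)
  have hi1 : Integrable (fun x => f x * A x) :=
    hf.mul_bdd (c := 1) (continuous_segAvg continuous_const _ hψ.continuous).aestronglyMeasurable
      (Filter.Eventually.of_forall (abs_segAvg_le (by simp) hb _))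
  have hi2 : Integrable (fun x => f x * partialDeriv k (fun y => -B y) x) :=
    hf.mul_bdd (c := C) (continuous_partialDeriv k hBs).aestronglyMeasurable
      (Filter.Eventually.of_forall hC)
  have h1 := hT k _ hBs hBc hBb
  have h2 : ∀ x, f x * ψ x = f x * A x + a * (f x * partialDeriv k (fun y => -B y) x) := by
    intro x
    nth_rewrite 1 [hid x]
    ring
  simp_rw [h2]
  rw [integral_add hi1 (hi2.const_mul a), integral_const_mul]
  exact add_le_add_right (mul_le_mul_of_nonneg_left h1 ha.le) _

lemma integral_mul_segAvg_segAvg_le (hf : Integrable f) (hψ : Continuous ψ)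
    (hc : HasCompactSupport ψ) {a b : ℝ} (ha : 0 < a) (hb : 0 < b) :
    ∫ x, f x * segAvg (fun _ => 1) (EuclideanSpace.single 1 b)
        (segAvg (fun _ => 1) (EuclideanSpace.single 0 a) ψ) x
      ≤ (a * b)⁻¹ * (∫ x, |f x|) * ∫ x, |ψ x| := by
  have h : ∀ x, ‖f x * segAvg (fun _ => 1) (EuclideanSpace.single 1 b)
        (segAvg (fun _ => 1) (EuclideanSpace.single 0 a) ψ) x‖
      ≤ |f x| * ((a * b)⁻¹ * ∫ y, |ψ y|) := fun x => by
    rw [norm_mul]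
    exact mul_le_mul_of_nonneg_left (abs_segAvg_segAvg_le hψ hc ha hb x) (abs_nonneg _)
  have := norm_integral_le_of_norm_le (hf.abs.mul_const _) (Filter.Eventually.of_forall h)
  rw [integral_mul_const] at this
  exact ((Real.le_norm_self _).trans this).trans_eq (by ring)

/-- Interpolation between `L¹` and the total variation, which yields the isoperimetric bound. -/
lemma integral_mul_le_of_variation (hf : Integrable f)
    (hT : ∀ (k : Fin 2) (Φ : Space 2 → ℝ), ContDiff ℝ 1 Φ → HasCompactSupport Φ →
      (∀ x, |Φ x| ≤ 1) → ∫ x, f x * partialDeriv k Φ x ≤ T)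
    (hψ : ContDiff ℝ ∞ ψ) (hc : HasCompactSupport ψ) (hb : ∀ x, |ψ x| ≤ 1)
    {a b : ℝ} (ha : 0 < a) (hb' : 0 < b) :
    ∫ x, f x * ψ x ≤ (a + b) * T + (a * b)⁻¹ * (∫ x, |f x|) * ∫ x, |ψ x| := by
  have h1 := integral_mul_le_add_segAvg hf hT hψ hc hb 0 ha
  have h2 := integral_mul_le_add_segAvg hf hT
    (contDiff_segAvg continuous_const (EuclideanSpace.single 0 a) hψ hc)
    (hasCompactSupport_segAvg _ _ hc) (abs_segAvg_le (w := fun _ => 1) (by simp) hb _) 1 hb'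
  have h3 := integral_mul_segAvg_segAvg_le hf hψ.continuous hc ha hb'
  linarith

/-- Smoothing at scale `a` in the direction `0` costs a factor `a⁻¹` for the derivative. -/
lemma integral_partialDeriv_segAvg_sq_le (hψ : ContDiff ℝ ∞ ψ) (hc : HasCompactSupport ψ)
    {a : ℝ} (ha : 0 < a) (v : Space 2) :
    ∫ x, partialDeriv 0 (segAvg (fun t => 1 - t) v
        (segAvg (fun _ => 1) (EuclideanSpace.single 0 a) ψ)) x ^ 2
      ≤ (2 / a) ^ 2 * ∫ x, ψ x ^ 2 := by
  have hψ1 : ContDiff ℝ 1 ψ := hψ.of_le (by simp)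
  set e : Space 2 := EuclideanSpace.single 0 a with he
  set A := segAvg (fun _ => 1) e ψ with hA
  have hAs : ContDiff ℝ ∞ A := contDiff_segAvg continuous_const _ hψ hc
  have hAc : HasCompactSupport A := hasCompactSupport_segAvg _ _ hc
  have hA1 : ContDiff ℝ 1 A := hAs.of_le (by simp)
  have hpA : ∀ x, partialDeriv 0 A x = a⁻¹ * (ψ (x + e) - ψ x) := by
    intro x
    have := fderiv_segAvg_one_apply_self hψ1 hc e x
    rw [he, fderiv_single, ← he, ← hA] at this
    rw [← this, ← mul_assoc, inv_mul_cancel₀ ha.ne', one_mul]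
  have h1 : ∀ x, partialDeriv 0 (segAvg (fun t => 1 - t) v A) x
      = segAvg (fun t => 1 - t) v (partialDeriv 0 A) x := fun x =>
    fderiv_segAvg_apply (by fun_prop) hA1 hAc v x _
  simp_rw [h1]
  refine (integral_segAvg_sq_le volume (by fun_prop)
    (fun t ht => abs_le.2 ⟨by linarith [ht.2], by linarith [ht.1]⟩)
    (continuous_partialDeriv 0 hA1) (hasCompactSupport_partialDeriv 0 hAc) v).trans ?_
  have hi := integrable_sq_of_hasCompactSupport volume hψ.continuous hc
  have hi' : Integrable fun x => ψ (x + e) ^ 2 := hi.comp_add_right e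
  have h2 : ∀ x, partialDeriv 0 A x ^ 2 ≤ a⁻¹ ^ 2 * (2 * ψ (x + e) ^ 2 + 2 * ψ x ^ 2) := by
    intro x
    rw [hpA, mul_pow]
    exact mul_le_mul_of_nonneg_left (by nlinarith [sq_nonneg (ψ (x + e) + ψ x)]) (sq_nonneg _)
  calc ∫ x, partialDeriv 0 A x ^ 2
      ≤ ∫ x, a⁻¹ ^ 2 * (2 * ψ (x + e) ^ 2 + 2 * ψ x ^ 2) :=
        integral_mono (integrable_sq_of_hasCompactSupport volume (continuous_partialDeriv 0 hA1)
          (hasCompactSupport_partialDeriv 0 hAc))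
          (((hi'.const_mul 2).add (hi.const_mul 2)).const_mul _) h2
    _ = (2 / a) ^ 2 * ∫ x, ψ x ^ 2 := by
        rw [integral_const_mul, integral_add (hi'.const_mul 2) (hi.const_mul 2),
          integral_const_mul, integral_const_mul,
          integral_add_right_eq_self (fun x => ψ x ^ 2) e]
        ring

/-- The low-volume-fraction interpolation inequality between elastic and surface energy. -/
lemma integral_mul_le_of_elastic (hf : Integrable f) (hf2 : MemLp f 2)
    (hT : ∀ (k : Fin 2) (Φ : Space 2 → ℝ), ContDiff ℝ 1 Φ → HasCompactSupport Φ →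
      (∀ x, |Φ x| ≤ 1) → ∫ x, f x * partialDeriv k Φ x ≤ T)
    (hψ : ContDiff ℝ ∞ ψ) (hc : HasCompactSupport ψ) (hb : ∀ x, |ψ x| ≤ 1)
    (u : SobolevH1 2) {E : ℝ} (hE0 : ∫ x, (u.grad x 0 0 - f x) ^ 2 ≤ E)
    (hE1 : ∫ x, u.grad x 0 1 ^ 2 ≤ E) {a b : ℝ} (ha : 0 < a) (hb' : 0 < b) :
    ∫ x, f x * ψ x ≤ a * T + (2 + 2 * (b / a)) * (√E * √(∫ x, ψ x ^ 2))
      + (a * b)⁻¹ * (∫ x, |f x|) * ∫ x, |ψ x| := by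
  have hw : Continuous fun t : ℝ => 1 - t := by fun_prop
  have hmem : ∀ {ζ : Space 2 → ℝ}, ContDiff ℝ ∞ ζ → HasCompactSupport ζ → MemLp ζ 2 volume :=
    fun h1 h2 => h1.continuous.memLp_of_hasCompactSupport h2
  have hmul : ∀ {p q : Space 2 → ℝ}, MemLp p 2 volume → MemLp q 2 volume →
      Integrable fun x => p x * q x := fun h1 h2 => h1.integrable_mul h2
  set A := segAvg (fun _ => 1) (EuclideanSpace.single 0 a) ψ with hA
  have hAs : ContDiff ℝ ∞ A := contDiff_segAvg continuous_const _ hψ hc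
  have hAc : HasCompactSupport A := hasCompactSupport_segAvg _ _ hc
  set D := segAvg (fun _ => 1) (EuclideanSpace.single 1 b) A with hD
  have hDs : ContDiff ℝ ∞ D := contDiff_segAvg continuous_const _ hAs hAc
  have hDc : HasCompactSupport D := hasCompactSupport_segAvg _ _ hAc
  set B := segAvg (fun t => 1 - t) (EuclideanSpace.single 1 b) A with hB
  have hBs : ContDiff ℝ ∞ B := contDiff_segAvg hw _ hAs hAc
  have hBc : HasCompactSupport B := hasCompactSupport_segAvg _ _ hAc
  have hAm := hmem hAs hAc
  have hDm := hmem hDs hDc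
  have hB0m := hmem (contDiff_partialDeriv 0 hBs) (hasCompactSupport_partialDeriv 0 hBc)
  have hB1m := hmem (contDiff_partialDeriv 1 hBs) (hasCompactSupport_partialDeriv 1 hBc)
  have hG0 := u.memLp_grad 0 0
  have hG1 := u.memLp_grad 0 1
  have hdiff : MemLp (fun x => u.grad x 0 0 - f x) 2 volume := hG0.sub hf2
  set Q := ∫ x, ψ x ^ 2 with hQ
  have hAQ : ∫ x, A x ^ 2 ≤ Q :=
    integral_segAvg_sq_le volume continuous_const (by simp) hψ.continuous hc _
  have hDQ : ∫ x, D x ^ 2 ≤ Q :=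
    (integral_segAvg_sq_le volume continuous_const (by simp) hAs.continuous hAc _).trans hAQ
  have hBQ : √(∫ x, partialDeriv 0 B x ^ 2) ≤ 2 / a * √Q := by
    have h := Real.sqrt_le_sqrt (integral_partialDeriv_segAvg_sq_le hψ hc ha
      (EuclideanSpace.single 1 b))
    rwa [Real.sqrt_mul (by positivity), Real.sqrt_sq (by positivity)] at h
  have s1 := integral_mul_le_add_segAvg hf hT hψ hc hb 0 ha
  have s5 := integral_mul_segAvg_segAvg_le hf hψ.continuous hc ha hb'
  rw [← hA] at s1 s5
  rw [← hD] at s5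
  have hfneg : MemLp (fun x => -(u.grad x 0 0 - f x)) 2 volume := hdiff.neg
  -- Pass from `f` to `∂₀u₀`; after averaging in direction 1, `s4` passes back.
  have s2 : ∫ x, f x * A x ≤ √E * √Q + ∫ x, u.grad x 0 0 * A x := by
    have h := integral_mul_le_sqrt_mul_sqrt hfneg hAm
    simp_rw [neg_sq] at h
    have h' : ∫ x, -(u.grad x 0 0 - f x) * A x
        = (∫ x, f x * A x) - ∫ x, u.grad x 0 0 * A x := by
      rw [← integral_sub (hmul hf2 hAm) (hmul hG0 hAm)]
      exact integral_congr_ae (Filter.Eventually.of_forall fun x => by ring)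
    have h'' : √(∫ x, (u.grad x 0 0 - f x) ^ 2) * √(∫ x, A x ^ 2) ≤ √E * √Q := by gcongr
    linarith
  have s4 : ∫ x, u.grad x 0 0 * D x ≤ √E * √Q + ∫ x, f x * D x := by
    have h := integral_mul_le_sqrt_mul_sqrt hdiff hDm
    have h' : ∫ x, (u.grad x 0 0 - f x) * D x
        = (∫ x, u.grad x 0 0 * D x) - ∫ x, f x * D x := by
      rw [← integral_sub (hmul hG0 hDm) (hmul hf2 hDm)]
      exact integral_congr_ae (Filter.Eventually.of_forall fun x => by ring)
    have h'' : √(∫ x, (u.grad x 0 0 - f x) ^ 2) * √(∫ x, D x ^ 2) ≤ √E * √Q := by gcongr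
    linarith
  have s3 : ∫ x, u.grad x 0 0 * A x ≤ 2 * (b / a) * (√E * √Q) + ∫ x, u.grad x 0 0 * D x := by
    have hid : ∀ x, A x = D x - b * partialDeriv 1 B x := by
      intro x
      have := fderiv_segAvg_linear_apply_self (hAs.of_le (by simp)) hAc
        (EuclideanSpace.single 1 b) x
      rw [fderiv_single, ← hB, ← hD] at this
      linarith
    have h' : ∫ x, u.grad x 0 0 * A x
        = (∫ x, u.grad x 0 0 * D x) - b * ∫ x, u.grad x 0 0 * partialDeriv 1 B x := by
      rw [← integral_const_mul, ← integral_sub (hmul hG0 hDm)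
        ((hmul hG0 hB1m).const_mul b)]
      refine integral_congr_ae (Filter.Eventually.of_forall fun x => ?_)
      simp only [hid x]
      ring
    -- The pairing of `∂₀u₀` with `∂₁B` becomes one of `∂₁u₀`, of squared norm at most `E`, with
    -- `∂₀B`, which costs `2 / a` because `A` is already averaged in direction 0.
    rw [u.isWeakGradient.integral_mul_partialDeriv_comm 0 0 1 hBs hBc] at h'
    have hG1n : MemLp (fun x => -u.grad x 0 1) 2 volume := hG1.neg
    have h := integral_mul_le_sqrt_mul_sqrt hG1n hB0m
    simp_rw [neg_sq, neg_mul] at h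
    rw [integral_neg] at h
    have h'' : √(∫ x, u.grad x 0 1 ^ 2) * √(∫ x, partialDeriv 0 B x ^ 2)
        ≤ √E * (2 / a * √Q) := by gcongr
    have h3 := mul_le_mul_of_nonneg_left (h.trans h'') hb'.le
    have h4 : b * (√E * (2 / a * √Q)) = 2 * (b / a) * (√E * √Q) := by ring
    linarith
  linarith

end NucleationInequalities

/-! ### Optimisation of the averaging lengths. -/

lemma lower_bound_of_interpolation {q V T E ε : ℝ} (hq : 0 < q) (hq1 : q ≤ 1) (hV : 0 < V)
    (hε : 0 < ε) (hE : 0 ≤ E)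
    (h1 : ∀ a b : ℝ, 0 < a → 0 < b → q ^ 2 * V / 2 ≤ (a + b) * T + (a * b)⁻¹ * V * V)
    (h2 : ∀ a b : ℝ, 0 < a → 0 < b →
      q ^ 2 * V / 2 ≤ a * T + (2 + 2 * (b / a)) * (√E * √V) + (a * b)⁻¹ * V * V) :
    q ^ 16 / 6144 ^ 2 * scalingLaw ε V ≤ E + ε * T := by
  obtain ⟨s, hs, hsV⟩ : ∃ s : ℝ, 0 < s ∧ V = s ^ 2 :=
    ⟨√V, Real.sqrt_pos.2 hV, (Real.sq_sqrt hV.le).symm⟩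
  have hsqrt : √V = s := by rw [hsV, Real.sqrt_sq hs.le]
  have hT : q ^ 3 * s / 16 ≤ T := by
    -- Chosen so that the last term is half of the left-hand side and can be absorbed.
    have h := h1 (2 * s / q) (2 * s / q) (by positivity) (by positivity)
    have e : (2 * s / q * (2 * s / q))⁻¹ * V * V = q ^ 2 * s ^ 2 / 4 := by
      rw [hsV]; field_simp; ring
    rw [e, hsV] at h
    have h3 : q ^ 2 * s ^ 2 / 4 ≤ 4 * s / q * T := by
      have : (2 * s / q + 2 * s / q) * T = 4 * s / q * T := by ring
      linarith
    have h4 := mul_le_mul_of_nonneg_left h3 (by positivity : 0 ≤ q / (4 * s))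
    have e1 : q / (4 * s) * (4 * s / q * T) = T := by field_simp
    have e2 : q / (4 * s) * (q ^ 2 * s ^ 2 / 4) = q ^ 3 * s / 16 := by field_simp; ring
    linarith
  have hT0 : 0 < T := lt_of_lt_of_le (by positivity) hT
  have hET : q ^ 16 / 6144 ^ 2 * V ^ 3 ≤ E * T ^ 4 := by
    -- Here `a T` and `V² / (a b)` both equal `q² V / 8`, so half of the left-hand side remains for
    -- the elastic term.
    have h := h2 (q ^ 2 * V / (8 * T)) (64 * T / q ^ 4) (by positivity) (by positivity)
    have e1 : (q ^ 2 * V / (8 * T) * (64 * T / q ^ 4))⁻¹ * V * V = q ^ 2 * V / 8 := by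
      field_simp; ring
    have e2 : q ^ 2 * V / (8 * T) * T = q ^ 2 * V / 8 := by field_simp
    have e3 : 64 * T / q ^ 4 / (q ^ 2 * V / (8 * T)) = 512 * T ^ 2 / (q ^ 6 * V) := by
      field_simp; ring
    rw [e1, e2, e3, hsqrt] at h
    -- The isoperimetric bound gives `b / a ≥ 2`, hence `2 + 2 b / a ≤ 3 b / a`; then `6144 = 4 *
    -- 1536`.
    have h3 : 2 ≤ 512 * T ^ 2 / (q ^ 6 * V) := by
      rw [le_div_iff₀ (by positivity), hsV]
      have := pow_le_pow_left₀ (by positivity) hT 2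
      nlinarith
    have h4 : q ^ 2 * V / 4 ≤ 1536 * T ^ 2 / (q ^ 6 * V) * (√E * s) := by
      have : (2 + 2 * (512 * T ^ 2 / (q ^ 6 * V))) * (√E * s)
          ≤ 3 * (512 * T ^ 2 / (q ^ 6 * V)) * (√E * s) :=
        mul_le_mul_of_nonneg_right (by linarith) (by positivity)
      have e4 : 3 * (512 * T ^ 2 / (q ^ 6 * V)) = 1536 * T ^ 2 / (q ^ 6 * V) := by ring
      rw [e4] at this
      linarith
    have h5 : q ^ 8 / 6144 * s ^ 3 ≤ √E * T ^ 2 := by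
      have h6 := mul_le_mul_of_nonneg_left h4 (by positivity : 0 ≤ q ^ 6 * V / (1536 * s))
      have e5 : q ^ 6 * V / (1536 * s) * (1536 * T ^ 2 / (q ^ 6 * V) * (√E * s)) = √E * T ^ 2 := by
        field_simp
      have e6 : q ^ 6 * V / (1536 * s) * (q ^ 2 * V / 4) = q ^ 8 / 6144 * s ^ 3 := by
        rw [hsV]; field_simp; ring
      linarith
    have h7 := pow_le_pow_left₀ (by positivity) h5 2
    calc q ^ 16 / 6144 ^ 2 * V ^ 3 = (q ^ 8 / 6144 * s ^ 3) ^ 2 := by rw [hsV]; ring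
      _ ≤ _ := h7
      _ = √E ^ 2 * T ^ 4 := by ring
      _ = E * T ^ 4 := by rw [Real.sq_sqrt hE]
  unfold scalingLaw
  split_ifs with hVε
  · rw [← Real.sqrt_eq_rpow, hsqrt]
    have h3 : q ^ 16 / 6144 ^ 2 * s ≤ q ^ 3 * s / 16 := by
      have : q ^ 16 ≤ q ^ 3 := pow_le_pow_of_le_one hq.le hq1 (by norm_num)
      have h16 := mul_le_mul_of_nonneg_right this hs.le
      have : 0 ≤ q ^ 16 * s := by positivity
      linarith
    have h4 := mul_le_mul_of_nonneg_left (h3.trans hT) hε.le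
    linarith
  · have hc0 : 0 ≤ q ^ 16 / 6144 ^ 2 := by positivity
    have hc1 : q ^ 16 / 6144 ^ 2 ≤ 1 := by
      have : q ^ 16 ≤ 1 := pow_le_one₀ hq.le hq1
      linarith
    have hr : (ε ^ (4 / 5 : ℝ) * V ^ (3 / 5 : ℝ)) ^ 5 = ε ^ 4 * V ^ 3 := by
      rw [mul_pow, ← Real.rpow_natCast, ← Real.rpow_natCast, ← Real.rpow_mul hε.le,
        ← Real.rpow_mul hV.le]
      norm_num
    -- Fifth powers remove the fractional exponents. The constant is at most one, so its fifth power
    -- may be replaced by itself, and `E T⁴ ≳ V³` becomes usable.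
    refine le_of_pow_le_pow_left₀ (n := 5) (by norm_num) (by positivity) ?_
    rw [mul_pow, hr]
    calc (q ^ 16 / 6144 ^ 2) ^ 5 * (ε ^ 4 * V ^ 3)
        ≤ q ^ 16 / 6144 ^ 2 * (ε ^ 4 * V ^ 3) :=
          mul_le_mul_of_nonneg_right (pow_le_of_le_one hc0 hc1 (by norm_num)) (by positivity)
      _ = ε ^ 4 * (q ^ 16 / 6144 ^ 2 * V ^ 3) := by ring
      _ ≤ ε ^ 4 * (E * T ^ 4) := mul_le_mul_of_nonneg_left hET (by positivity)
      _ = E * (ε * T) ^ 4 := by ring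
      _ ≤ (E + ε * T) * (E + ε * T) ^ 4 := by
          have : 0 ≤ ε * T := by positivity
          gcongr <;> linarith
      _ = (E + ε * T) ^ 5 := by ring

/-! ### From phase fields to the interpolation inequalities. -/

section PhaseField

variable {l : ℝ} {χ : Space 2 → Matrix (Fin 2) (Fin 2) ℝ}

lemma ae_wells (hχ : IsPhaseField (twoWells l) χ) : ∀ᵐ x ∂(volume : Measure (Space 2)),
    χ x 0 1 = 0 ∧ ((χ x = 0 ∧ χ x 0 0 = 0) ∨ χ x = Matrix.diagonal ![-l, 0] ∧ χ x 0 0 = -l ∨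
      χ x = Matrix.diagonal ![1 - l, 0] ∧ χ x 0 0 = 1 - l) := by
  filter_upwards [hχ.mem_wells] with x hx
  simp only [twoWells, Set.union_singleton, Set.mem_insert_iff, Set.mem_singleton_iff] at hx
  rcases hx with h | h | h <;> simp [h]

lemma ae_abs_le_one (hl0 : 0 < l) (hl1 : l < 1) (hχ : IsPhaseField (twoWells l) χ) :
    ∀ᵐ x ∂(volume : Measure (Space 2)), |χ x 0 0| ≤ 1 := by
  filter_upwards [ae_wells hχ] with x hx
  rcases hx.2 with h | h | h <;> rw [h.2, abs_le] <;> constructor <;> linarith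

lemma integrable_sq_of_phaseField (hl0 : 0 < l) (hl1 : l < 1)
    (hχ : IsPhaseField (twoWells l) χ) : Integrable fun x => χ x 0 0 ^ 2 := by
  simp_rw [pow_two]
  exact (hχ.integrable 0 0).bdd_mul (hχ.integrable 0 0).aestronglyMeasurable (c := 1)
    (ae_abs_le_one hl0 hl1 hχ)

/-- For `0 < l < 1` both wells have nonzero top-left entry, so this entry alone detects the
inclusion almost everywhere. -/
lemma volume_support_eq (hl0 : 0 < l) (hl1 : l < 1) (hχ : IsPhaseField (twoWells l) χ) :
    volume {x | χ x 0 0 ≠ 0} = volume {x | χ x ≠ 0} := by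
  refine measure_congr ?_
  filter_upwards [ae_wells hχ] with x hx
  refine propext (not_congr ⟨fun h => ?_, fun h => ?_⟩)
  · rcases hx.2 with h' | h' | h'
    · exact h'.1
    · linarith [h'.2.symm.trans h]
    · linarith [h'.2.symm.trans h]
  · exact congrFun (congrFun h 0) 0

lemma integral_abs_le_volume (hl0 : 0 < l) (hl1 : l < 1) (hχ : IsPhaseField (twoWells l) χ)
    {V : ℝ} (hV : 0 ≤ V) (hvol : volume {x | χ x ≠ 0} = ENNReal.ofReal V) :
    ∫ x, |χ x 0 0| ≤ V := by
  have hS := (volume_support_eq hl0 hl1 hχ).trans hvol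
  rw [← setIntegral_eq_integral_of_forall_compl_eq_zero (s := {x | χ x 0 0 ≠ 0})
    fun x hx => by simpa using hx]
  have h := setIntegral_mono_ae (μ := volume) (s := {x | χ x 0 0 ≠ 0})
    (hχ.integrable 0 0).abs.integrableOn
    (integrableOn_const (C := (1 : ℝ)) (by simp [hS])) (ae_abs_le_one hl0 hl1 hχ)
  refine h.trans_eq ?_
  simp [Measure.real, hS, hV]

lemma le_integral_sq (hl0 : 0 < l) (hl1 : l < 1) (hχ : IsPhaseField (twoWells l) χ)
    {V : ℝ} (hV : 0 ≤ V) (hvol : volume {x | χ x ≠ 0} = ENNReal.ofReal V) :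
    min l (1 - l) ^ 2 * V ≤ ∫ x, χ x 0 0 ^ 2 := by
  have hS := (volume_support_eq hl0 hl1 hχ).trans hvol
  have hi := integrable_sq_of_phaseField hl0 hl1 hχ
  have hnm : NullMeasurableSet {x | χ x 0 0 ≠ 0} volume :=
    (hχ.integrable 0 0).aestronglyMeasurable.aemeasurable.nullMeasurable
      (measurableSet_singleton (0 : ℝ)).compl
  have hq : 0 ≤ min l (1 - l) := le_min hl0.le (by linarith)
  rw [← setIntegral_eq_integral_of_forall_compl_eq_zero (s := {x | χ x 0 0 ≠ 0})
    fun x hx => by simpa using hx]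
  have h := setIntegral_mono_on_ae₀ (μ := volume) (s := {x | χ x 0 0 ≠ 0})
    (f := fun _ => min l (1 - l) ^ 2)
    (integrableOn_const (by simp [hS])) hi.integrableOn hnm (by
      filter_upwards [ae_wells hχ] with x hx hne
      rcases hx.2 with h' | h' | h'
      · exact absurd h'.2 hne
      · rw [h'.2, neg_sq]
        exact pow_le_pow_left₀ hq (min_le_left _ _) 2
      · rw [h'.2]
        exact pow_le_pow_left₀ hq (min_le_right _ _) 2)
  refine le_of_eq_of_le ?_ h
  simp [Measure.real, hS, hV, mul_comm]

/-- Each integral keeps one entry of the Frobenius norm; the second uses that `χ₀₁ = 0` almost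
everywhere. -/
lemma integral_sq_le_elasticEnergy (hχ : IsPhaseField (twoWells l) χ) (u : SobolevH1 2)
    (hu : elasticEnergy u χ ≠ ⊤) :
    ∫ x, (u.grad x 0 0 - χ x 0 0) ^ 2 ≤ (elasticEnergy u χ).toReal ∧
      ∫ x, u.grad x 0 1 ^ 2 ≤ (elasticEnergy u χ).toReal := by
  have hm0 := (u.memLp_grad 0 0).aestronglyMeasurable
  have hm1 := (u.memLp_grad 0 1).aestronglyMeasurable
  constructor
  · have hm : AEStronglyMeasurable (fun x => (u.grad x 0 0 - χ x 0 0) ^ 2) volume :=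
      (hm0.sub (hχ.integrable 0 0).aestronglyMeasurable).pow 2
    rw [integral_eq_lintegral_of_nonneg_ae (Filter.Eventually.of_forall fun x => sq_nonneg _) hm]
    refine ENNReal.toReal_mono hu (lintegral_mono fun x => ENNReal.ofReal_le_ofReal ?_)
    simp only [Fin.sum_univ_two]
    nlinarith [sq_nonneg (u.grad x 0 1 - χ x 0 1), sq_nonneg (u.grad x 1 0 - χ x 1 0),
      sq_nonneg (u.grad x 1 1 - χ x 1 1)]
  · have hm : AEStronglyMeasurable (fun x => u.grad x 0 1 ^ 2) volume := hm1.pow 2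
    rw [integral_eq_lintegral_of_nonneg_ae (Filter.Eventually.of_forall fun x => sq_nonneg _) hm]
    refine ENNReal.toReal_mono hu (lintegral_mono_ae ?_)
    filter_upwards [ae_wells hχ] with x hx
    refine ENNReal.ofReal_le_ofReal ?_
    simp only [Fin.sum_univ_two, hx.1, sub_zero]
    nlinarith [sq_nonneg (u.grad x 0 0 - χ x 0 0), sq_nonneg (u.grad x 1 0 - χ x 1 0),
      sq_nonneg (u.grad x 1 1 - χ x 1 1)]

lemma le_elastic_add_surface (hl0 : 0 < l) (hl1 : l < 1) (hχ : IsPhaseField (twoWells l) χ)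
    {V ε : ℝ} (hV : 0 < V) (hε : 0 < ε) (hvol : volume {x | χ x ≠ 0} = ENNReal.ofReal V)
    (u : SobolevH1 2) (hu : elasticEnergy u χ ≠ ⊤) :
    min l (1 - l) ^ 16 / 6144 ^ 2 * scalingLaw ε V
      ≤ (elasticEnergy u χ).toReal + ε * (totalVariation χ).toReal := by
  have hq : 0 < min l (1 - l) := lt_min hl0 (by linarith)
  have hfi := hχ.integrable 0 0
  have hfb := ae_abs_le_one hl0 hl1 hχ
  have hfV := integral_abs_le_volume hl0 hl1 hχ hV.le hvol
  have hf2 : MemLp (fun x => χ x 0 0) 2 volume :=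
    (memLp_two_iff_integrable_sq hfi.aestronglyMeasurable).2
      (integrable_sq_of_phaseField hl0 hl1 hχ)
  -- Halving `q² V` supplies the strict inequality that the test function needs.
  obtain ⟨ψ, hψ, hc, hb, hψ1, hψf⟩ := exists_smooth_test hfi hfb
    (c := min l (1 - l) ^ 2 * V / 2)
    (lt_of_lt_of_le (half_lt_self (by positivity)) (le_integral_sq hl0 hl1 hχ hV.le hvol))
  have hψV := hψ1.trans hfV
  have hψ2 : ∫ x, ψ x ^ 2 ≤ V := by
    refine (integral_mono (integrable_sq_of_hasCompactSupport volume hψ.continuous hc)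
      (hψ.continuous.integrable_of_hasCompactSupport hc).abs fun x => ?_).trans hψV
    rw [← sq_abs]
    exact pow_le_of_le_one (abs_nonneg _) (hb x) two_ne_zero
  have hT := fun k Φ h1 h2 h3 => integral_mul_partialDeriv_le_totalVariation
    hχ.totalVariation_lt_top k (Φ := Φ) h1 h2 h3
  have hprod : ∀ a b : ℝ, 0 < a → 0 < b →
      (a * b)⁻¹ * (∫ x, |χ x 0 0|) * ∫ x, |ψ x| ≤ (a * b)⁻¹ * V * V := fun a b ha hb' =>
    mul_le_mul (mul_le_mul_of_nonneg_left hfV (by positivity)) hψV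
      (integral_nonneg fun x => abs_nonneg _) (by positivity)
  obtain ⟨hE0, hE1⟩ := integral_sq_le_elasticEnergy hχ u hu
  refine lower_bound_of_interpolation hq ((min_le_left _ _).trans hl1.le) hV hε
    ENNReal.toReal_nonneg (fun a b ha hb' => ?_) fun a b ha hb' => ?_
  · have h := integral_mul_le_of_variation hfi hT hψ hc hb ha hb'
    linarith [hprod a b ha hb']
  · have h := integral_mul_le_of_elastic hfi hf2 hT hψ hc hb u hE0 hE1 ha hb'
    have h3 : (2 + 2 * (b / a)) * (√(elasticEnergy u χ).toReal * √(∫ x, ψ x ^ 2))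
        ≤ (2 + 2 * (b / a)) * (√(elasticEnergy u χ).toReal * √V) := by gcongr
    linarith [hprod a b ha hb']

end PhaseField

/-- The lower scaling bound. -/
theorem scalingLaw_le_minimalEnergy {l V ε : ℝ} (hl0 : 0 < l) (hl1 : l < 1) (hV : 0 < V)
    (hε : 0 < ε) :
    ENNReal.ofReal (min l (1 - l) ^ 16 / 6144 ^ 2 * scalingLaw ε V)
      ≤ minimalEnergy (twoWells l) ε V := by
  refine le_iInf fun χ => le_iInf fun hχ => le_iInf fun hvol => ?_
  rw [totalEnergy, relaxedElasticEnergy, ENNReal.iInf_add]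
  refine le_iInf fun u => ?_
  by_cases hu : elasticEnergy u χ = ⊤
  · simp [hu]
  · have h := le_elastic_add_surface hl0 hl1 hχ hV hε hvol u hu
    refine (ENNReal.ofReal_le_ofReal h).trans_eq ?_
    rw [ENNReal.ofReal_add ENNReal.toReal_nonneg (mul_nonneg hε.le ENNReal.toReal_nonneg),
      ENNReal.ofReal_mul hε.le, ENNReal.ofReal_toReal hu,
      ENNReal.ofReal_toReal hχ.totalVariation_lt_top.ne]

/-! ### Slicing the plane along coordinate lines. -/

section Plane

lemma ae_plane {P : Space 2 → Prop} (hP : MeasurableSet {x | P x})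
    (h : ∀ᵐ s : ℝ, ∀ᵐ t : ℝ, P !₂[s, t]) : ∀ᵐ x : Space 2, P x := by
  rw [← measurePreserving_planeEquiv.map_eq,
    ae_map_iff planeEquiv.measurable.aemeasurable hP, Measure.volume_eq_prod]
  exact (Measure.ae_prod_iff_ae_ae (p := fun y => P (planeEquiv y)) (planeEquiv.measurable hP)).2 h

lemma volume_plane {S : Set (Space 2)} (hS : MeasurableSet S) :
    volume S = ∫⁻ t : ℝ, volume {s : ℝ | !₂[s, t] ∈ S} := by
  rw [← measurePreserving_planeEquiv.measure_preimage hS.nullMeasurableSet,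
    Measure.volume_eq_prod, Measure.prod_apply_symm (planeEquiv.measurable hS)]
  rfl

lemma integral_plane_symm {g : Space 2 → ℝ} (hg : Integrable g) :
    ∫ x, g x = ∫ t : ℝ, ∫ s : ℝ, g !₂[s, t] := by
  rw [← measurePreserving_planeEquiv.integral_comp', Measure.volume_eq_prod, integral_prod_symm]
  · rfl
  · exact (measurePreserving_planeEquiv.integrable_comp_emb planeEquiv.measurableEmbedding).2 hg

lemma hasDerivAt_plane_zero {φ : Space 2 → ℝ} (hφ : ContDiff ℝ 1 φ) (s t : ℝ) :
    HasDerivAt (fun r : ℝ => φ !₂[r, t]) (partialDeriv 0 φ !₂[s, t]) s := by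
  have h := hasDerivAt_comp_segment hφ (EuclideanSpace.single 0 1) !₂[0, t] s
  have e : ∀ r : ℝ, (!₂[0, t] : Space 2) + r • EuclideanSpace.single (0 : Fin 2) (1 : ℝ)
      = !₂[r, t] := fun r => by
    ext i
    fin_cases i <;> simp
  simp_rw [e] at h
  exact h

lemma hasDerivAt_plane_one {φ : Space 2 → ℝ} (hφ : ContDiff ℝ 1 φ) (s t : ℝ) :
    HasDerivAt (fun r : ℝ => φ !₂[s, r]) (partialDeriv 1 φ !₂[s, t]) t := by
  have h := hasDerivAt_comp_segment hφ (EuclideanSpace.single 1 1) !₂[s, 0] t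
  have e : ∀ r : ℝ, (!₂[s, 0] : Space 2) + r • EuclideanSpace.single (1 : Fin 2) (1 : ℝ)
      = !₂[s, r] := fun r => by
    ext i
    fin_cases i <;> simp
  simp_rw [e] at h
  exact h

lemma continuous_plane : Continuous fun p : ℝ × ℝ => (!₂[p.1, p.2] : Space 2) := by
  fun_prop

end Plane

lemma abs_setIntegral_Ioo_deriv_le {ζ ζ' : ℝ → ℝ} (hd : ∀ t, HasDerivAt ζ (ζ' t) t)
    (hc : Continuous ζ') (hb : ∀ t, |ζ t| ≤ 1) (a b : ℝ) : |∫ t in Set.Ioo a b, ζ' t| ≤ 2 := by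
  rcases le_or_gt a b with hab | hab
  · rw [← integral_Ioc_eq_integral_Ioo, ← intervalIntegral.integral_of_le hab,
      intervalIntegral.integral_eq_sub_of_hasDerivAt (fun t _ => hd t) (hc.intervalIntegrable _ _)]
    exact (abs_sub _ _).trans (by linarith [hb a, hb b])
  · rw [Set.Ioo_eq_empty (by linarith)]
    simp

/-! ### The diamond-shaped inclusion: slices, volume and total variation. -/

/-- The longitudinal slope of the wells in the rising and the falling part of the inclusion. -/
noncomputable def tentSlope (l s : ℝ) : ℝ := if s < 0 then 1 - l else -l

/-- The affine pieces whose positive part is the displacement of the inclusion. -/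
noncomputable def tentHeight (l w L : ℝ) (x : Space 2) : ℝ :=
  l * (1 - l) * (w - w / L * |x 1|) - max (-(1 - l) * x 0) (l * x 0)

/-- The diamond-shaped inclusion of width `w` and length `2 * L`. -/
noncomputable def tentField (l w L : ℝ) (x : Space 2) : Matrix (Fin 2) (Fin 2) ℝ :=
  if 0 < tentHeight l w L x then Matrix.diagonal ![tentSlope l (x 0), 0] else 0

lemma abs_tentSlope_le {l : ℝ} (hl0 : 0 < l) (hl1 : l < 1) (s : ℝ) : |tentSlope l s| ≤ 1 := by
  unfold tentSlope
  split_ifs <;> rw [abs_le] <;> constructor <;> linarith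

lemma tentSlope_ne_zero {l : ℝ} (hl0 : 0 < l) (hl1 : l < 1) (s : ℝ) : tentSlope l s ≠ 0 := by
  unfold tentSlope
  split_ifs <;> linarith

lemma measurable_tentSlope (l : ℝ) : Measurable (tentSlope l) :=
  Measurable.ite measurableSet_Iio measurable_const measurable_const

lemma tentField_zero_zero (l w L : ℝ) (x : Space 2) :
    tentField l w L x 0 0 = if 0 < tentHeight l w L x then tentSlope l (x 0) else 0 := by
  unfold tentField
  split_ifs <;> simp

lemma tentField_apply_of_ne (l w L : ℝ) (x : Space 2) {i j : Fin 2} (h : ¬(i = 0 ∧ j = 0)) :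
    tentField l w L x i j = 0 := by
  unfold tentField
  split_ifs
  · fin_cases i <;> fin_cases j <;> simp at h ⊢
  · rfl

lemma continuous_tentHeight (l w L : ℝ) : Continuous (tentHeight l w L) := by
  unfold tentHeight
  fun_prop

/-- Each branch of the maximum gives one endpoint. The factor `l (1 - l)` normalises the slice to
length `w - w / L * |t|` when this is positive, so the total area is `w L`. -/
lemma tentHeight_pos_iff_slice {l : ℝ} (hl0 : 0 < l) (hl1 : l < 1) (w L s t : ℝ) :
    0 < tentHeight l w L !₂[s, t]
      ↔ s ∈ Set.Ioo (-(l * (w - w / L * |t|))) ((1 - l) * (w - w / L * |t|)) := by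
  have h1 : 0 < 1 - l := by linarith
  simp only [tentHeight, sub_pos, max_lt_iff, Set.mem_Ioo]
  simp only [Matrix.cons_val_zero, Matrix.cons_val_one]
  refine and_congr ⟨fun h => ?_, fun h => ?_⟩ ⟨fun h => ?_, fun h => ?_⟩ <;> nlinarith

lemma tentHeight_pos_iff_slice_symm {l w L : ℝ} (hl0 : 0 < l) (hl1 : l < 1) (hw : 0 < w)
    (hL : 0 < L) (s t : ℝ) :
    0 < tentHeight l w L !₂[s, t]
      ↔ t ∈ Set.Ioo (-(L / w * (w - max (-(1 - l) * s) (l * s) / (l * (1 - l)))))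
        (L / w * (w - max (-(1 - l) * s) (l * s) / (l * (1 - l)))) := by
  have hc : 0 < l * (1 - l) := mul_pos hl0 (by linarith)
  rw [Set.mem_Ioo, ← abs_lt]
  simp only [tentHeight, sub_pos]
  simp only [Matrix.cons_val_zero, Matrix.cons_val_one]
  rw [← div_lt_iff₀' hc, lt_sub_comm, div_mul_eq_mul_div, div_lt_iff₀ hL, div_mul_eq_mul_div,
    lt_div_iff₀ hw, mul_comm w |t|, mul_comm _ L]

lemma mem_Ioo_of_tentHeight_pos {l w L : ℝ} (hl0 : 0 < l) (hl1 : l < 1) (hw : 0 < w)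
    (hL : 0 < L) {x : Space 2} (h : 0 < tentHeight l w L x) :
    x 0 ∈ Set.Ioo (-(l * w)) ((1 - l) * w) ∧ x 1 ∈ Set.Ioo (-L) L := by
  have e : x = !₂[x 0, x 1] := by
    ext i
    fin_cases i <;> simp
  rw [e, tentHeight_pos_iff_slice hl0 hl1] at h
  have h1 : 0 < 1 - l := by linarith
  have hn : 0 ≤ w / L * |x 1| := by positivity
  have hpos : 0 < w - w / L * |x 1| := by nlinarith [h.1.trans h.2]
  refine ⟨⟨by nlinarith [h.1], by nlinarith [h.2]⟩, ?_⟩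
  rw [Set.mem_Ioo, ← abs_lt]
  rw [sub_pos, div_mul_eq_mul_div, div_lt_iff₀ hL] at hpos
  exact lt_of_mul_lt_mul_left hpos hw.le

lemma lintegral_ofReal_hat {w L : ℝ} (hw : 0 < w) (hL : 0 < L) :
    ∫⁻ t : ℝ, ENNReal.ofReal (w - w / L * |t|) = ENNReal.ofReal (w * L) := by
  have hcont : Continuous fun t : ℝ => w - w / L * |t| := by fun_prop
  have h1 : ∫⁻ t : ℝ, ENNReal.ofReal (w - w / L * |t|)
      = ∫⁻ t in Set.Ioc (-L) L, ENNReal.ofReal (w - w / L * |t|) := by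
    rw [← lintegral_indicator measurableSet_Ioc]
    refine lintegral_congr fun t => ?_
    by_cases ht : t ∈ Set.Ioc (-L) L
    · rw [Set.indicator_of_mem ht]
    · rw [Set.indicator_of_notMem ht, ENNReal.ofReal_eq_zero, sub_nonpos, div_mul_eq_mul_div,
        le_div_iff₀ hL]
      refine mul_le_mul_of_nonneg_left ?_ hw.le
      by_contra hlt
      exact ht ⟨(abs_lt.1 (not_le.1 hlt)).1, (abs_lt.1 (not_le.1 hlt)).2.le⟩
  have h2 : ∫ t in (-L)..L, (w - w / L * |t|) = w * L := by
    rw [← intervalIntegral.integral_add_adjacent_intervals (b := 0)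
      (hcont.intervalIntegrable _ _) (hcont.intervalIntegrable _ _)]
    have e1 : ∫ t in (-L)..0, (w - w / L * |t|) = ∫ t in (-L)..0, (w + w / L * t) := by
      refine intervalIntegral.integral_congr fun t ht => ?_
      rw [Set.uIcc_of_le (by linarith)] at ht
      simp only [abs_of_nonpos ht.2]
      ring
    have e2 : ∫ t in (0 : ℝ)..L, (w - w / L * |t|) = ∫ t in (0 : ℝ)..L, (w - w / L * t) := by
      refine intervalIntegral.integral_congr fun t ht => ?_
      rw [Set.uIcc_of_le hL.le] at ht
      simp only [abs_of_nonneg ht.1]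
    rw [e1, e2, intervalIntegral.integral_add, intervalIntegral.integral_sub,
      intervalIntegral.integral_const_mul, intervalIntegral.integral_const_mul]
    · simp only [intervalIntegral.integral_const, integral_id, smul_eq_mul]
      field_simp
      ring
    all_goals exact (by fun_prop : Continuous _).intervalIntegrable _ _
  rw [h1, ← h2, intervalIntegral.integral_of_le (by linarith),
    ofReal_integral_eq_lintegral_ofReal hcont.integrableOn_Ioc]
  refine (ae_restrict_iff' measurableSet_Ioc).2 (Filter.Eventually.of_forall fun t ht => ?_)
  change (0 : ℝ) ≤ w - w / L * |t|
  rw [sub_nonneg, div_mul_eq_mul_div, div_le_iff₀ hL]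
  exact mul_le_mul_of_nonneg_left (abs_le.2 ⟨ht.1.le, ht.2⟩) hw.le

section Tent

variable {l w L : ℝ}

lemma measurableSet_tent (l w L : ℝ) : MeasurableSet {x | 0 < tentHeight l w L x} :=
  (isOpen_lt continuous_const (continuous_tentHeight l w L)).measurableSet

lemma volume_tent (hl0 : 0 < l) (hl1 : l < 1) (hw : 0 < w) (hL : 0 < L) :
    volume {x | 0 < tentHeight l w L x} = ENNReal.ofReal (w * L) := by
  rw [volume_plane (measurableSet_tent l w L), ← lintegral_ofReal_hat hw hL]
  refine lintegral_congr fun t => ?_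
  have : {s : ℝ | !₂[s, t] ∈ {x | 0 < tentHeight l w L x}}
      = Set.Ioo (-(l * (w - w / L * |t|))) ((1 - l) * (w - w / L * |t|)) :=
    Set.ext fun s => tentHeight_pos_iff_slice hl0 hl1 w L s t
  rw [this, Real.volume_Ioo]
  congr 1
  ring

lemma tentField_ne_zero_iff (hl0 : 0 < l) (hl1 : l < 1) (x : Space 2) :
    tentField l w L x ≠ 0 ↔ 0 < tentHeight l w L x := by
  refine ⟨fun h => by_contra fun hn => h (if_neg hn), fun h h0 => ?_⟩
  have := congrFun (congrFun h0 0) 0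
  rw [tentField_zero_zero, if_pos h] at this
  exact tentSlope_ne_zero hl0 hl1 _ this

lemma measurable_tentField_zero_zero (l w L : ℝ) :
    Measurable fun x => tentField l w L x 0 0 := by
  simp_rw [tentField_zero_zero]
  exact Measurable.ite (measurableSet_tent l w L)
    ((measurable_tentSlope l).comp (by fun_prop)) measurable_const

lemma abs_tentField_zero_zero_le (hl0 : 0 < l) (hl1 : l < 1) (x : Space 2) :
    |tentField l w L x 0 0| ≤ 1 := by
  rw [tentField_zero_zero]
  split_ifs
  exacts [abs_tentSlope_le hl0 hl1 _, by simp]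

lemma integrable_indicator_tent (hl0 : 0 < l) (hl1 : l < 1) (hw : 0 < w) (hL : 0 < L) (M : ℝ) :
    Integrable ({x | 0 < tentHeight l w L x}.indicator fun _ => M) :=
  (integrableOn_const (by simp [volume_tent hl0 hl1 hw hL])).integrable_indicator
    (measurableSet_tent l w L)

lemma integrable_tentField (hl0 : 0 < l) (hl1 : l < 1) (hw : 0 < w) (hL : 0 < L) (i j : Fin 2) :
    Integrable fun x => tentField l w L x i j := by
  by_cases h : i = 0 ∧ j = 0
  · obtain ⟨rfl, rfl⟩ := h
    refine (integrable_indicator_tent hl0 hl1 hw hL 1).mono'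
      (measurable_tentField_zero_zero l w L).aestronglyMeasurable
      (Filter.Eventually.of_forall fun x => ?_)
    by_cases hx : 0 < tentHeight l w L x
    · rw [Set.indicator_of_mem (by exact hx)]
      exact abs_tentField_zero_zero_le hl0 hl1 x
    · rw [Set.indicator_of_notMem (by exact hx), tentField_zero_zero, if_neg hx, norm_zero]
  · simp_rw [tentField_apply_of_ne l w L _ h]
    exact integrable_zero _ _ _

lemma integrable_tentField_mul (hl0 : 0 < l) (hl1 : l < 1) {φ : Space 2 → ℝ}
    (hφ : ContDiff ℝ 1 φ) (hc : HasCompactSupport φ) (k : Fin 2) :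
    Integrable fun x => tentField l w L x 0 0 * partialDeriv k φ x :=
  ((continuous_partialDeriv k hφ).integrable_of_hasCompactSupport
    (hasCompactSupport_partialDeriv k hc)).bdd_mul
    (measurable_tentField_zero_zero l w L).aestronglyMeasurable (c := 1)
    (Filter.Eventually.of_forall (abs_tentField_zero_zero_le hl0 hl1))

/-- On a horizontal slice the field is `1 - l` on one interval and `-l` on the next. Each interval
contributes at most 2 times its weight, and the weights `1 - l` and `l` add up to one. -/
lemma abs_integral_tentField_slice_zero_le (hl0 : 0 < l) (hl1 : l < 1) (hw : 0 < w) (hL : 0 < L)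
    {φ : Space 2 → ℝ} (hφ : ContDiff ℝ 1 φ) (hb : ∀ x, |φ x| ≤ 1) (t : ℝ) :
    |∫ s : ℝ, tentField l w L !₂[s, t] 0 0 * partialDeriv 0 φ !₂[s, t]|
      ≤ (Set.Ioo (-L) L).indicator (fun _ => 2) t := by
  set h : ℝ := w - w / L * |t| with hh
  set ζ' : ℝ → ℝ := fun s => partialDeriv 0 φ !₂[s, t] with hζ
  have hζc : Continuous ζ' := (continuous_partialDeriv 0 hφ).comp
    (continuous_plane.comp (continuous_id.prodMk continuous_const))
  have hζd : ∀ s, HasDerivAt (fun r : ℝ => φ !₂[r, t]) (ζ' s) s :=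
    fun s => hasDerivAt_plane_zero hφ s t
  by_cases ht : t ∈ Set.Ioo (-L) L
  · rw [Set.indicator_of_mem ht]
    have h0 : 0 < h := by
      have : |t| < L := abs_lt.2 ht
      rw [hh, sub_pos, div_mul_eq_mul_div, div_lt_iff₀ hL]
      exact mul_lt_mul_of_pos_left this hw
    have hpt : ∀ s, tentField l w L !₂[s, t] 0 0 * ζ' s
        = (1 - l) * (Set.Ioo (-(l * h)) 0).indicator ζ' s
          - l * (Set.Ico 0 ((1 - l) * h)).indicator ζ' s := by
      intro s
      have hm := tentHeight_pos_iff_slice hl0 hl1 w L s t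
      have hlh : 0 < l * h := mul_pos hl0 h0
      have hlh' : 0 < (1 - l) * h := mul_pos (by linarith) h0
      rw [tentField_zero_zero, ← hh] at *
      have e0 : (!₂[s, t] : Space 2) 0 = s := rfl
      by_cases hs : s < 0
      · have n2 : s ∉ Set.Ico 0 ((1 - l) * h) := fun hx => absurd hx.1 (not_le.2 hs)
        by_cases hs' : -(l * h) < s
        · rw [if_pos (hm.2 ⟨hs', hs.trans hlh'⟩), Set.indicator_of_mem (show s ∈ Set.Ioo _ _ from
            ⟨hs', hs⟩), Set.indicator_of_notMem n2, e0, tentSlope, if_pos hs]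
          ring
        · rw [if_neg (fun hx => hs' (hm.1 hx).1), Set.indicator_of_notMem (fun hx => hs' hx.1),
            Set.indicator_of_notMem n2]
          ring
      · have n1 : s ∉ Set.Ioo (-(l * h)) 0 := fun hx => hs hx.2
        by_cases hs' : s < (1 - l) * h
        · rw [if_pos (hm.2 ⟨by linarith, hs'⟩), Set.indicator_of_mem (show s ∈ Set.Ico _ _ from
            ⟨not_lt.1 hs, hs'⟩), Set.indicator_of_notMem n1, e0, tentSlope, if_neg hs]
          ring
        · rw [if_neg (fun hx => hs' (hm.1 hx).2), Set.indicator_of_notMem n1,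
            Set.indicator_of_notMem (fun hx => hs' hx.2)]
          ring
    have hi1 : Integrable ((Set.Ioo (-(l * h)) 0).indicator ζ') :=
      ((hζc.integrableOn_Icc).mono_set Set.Ioo_subset_Icc_self).integrable_indicator
        measurableSet_Ioo
    have hi2 : Integrable ((Set.Ico 0 ((1 - l) * h)).indicator ζ') :=
      ((hζc.integrableOn_Icc).mono_set Set.Ico_subset_Icc_self).integrable_indicator
        measurableSet_Ico
    change |∫ s : ℝ, tentField l w L !₂[s, t] 0 0 * ζ' s| ≤ 2
    simp_rw [hpt]
    rw [integral_sub (hi1.const_mul _) (hi2.const_mul _), integral_const_mul, integral_const_mul,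
      integral_indicator measurableSet_Ioo, integral_indicator measurableSet_Ico,
      integral_Ico_eq_integral_Ioo]
    have b1 := abs_setIntegral_Ioo_deriv_le hζd hζc (fun s => hb _) (-(l * h)) 0
    have b2 := abs_setIntegral_Ioo_deriv_le hζd hζc (fun s => hb _) 0 ((1 - l) * h)
    rw [abs_le] at b1 b2 ⊢
    constructor <;> nlinarith
  · have hz : ∀ s : ℝ, tentField l w L !₂[s, t] 0 0 = 0 := fun s => by
      rw [tentField_zero_zero, if_neg]
      exact fun hx => ht (mem_Ioo_of_tentHeight_pos hl0 hl1 hw hL hx).2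
    simp [Set.indicator_of_notMem ht, hz]

/-- On a vertical slice the slope is constant and the inclusion is a single interval. -/
lemma abs_integral_tentField_slice_one_le (hl0 : 0 < l) (hl1 : l < 1) (hw : 0 < w) (hL : 0 < L)
    {φ : Space 2 → ℝ} (hφ : ContDiff ℝ 1 φ) (hb : ∀ x, |φ x| ≤ 1) (s : ℝ) :
    |∫ t : ℝ, tentField l w L !₂[s, t] 0 0 * partialDeriv 1 φ !₂[s, t]|
      ≤ (Set.Ioo (-(l * w)) ((1 - l) * w)).indicator (fun _ => 2) s := by
  by_cases hs : s ∈ Set.Ioo (-(l * w)) ((1 - l) * w)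
  · rw [Set.indicator_of_mem hs]
    set k : ℝ := L / w * (w - max (-(1 - l) * s) (l * s) / (l * (1 - l))) with hk
    set ζ' : ℝ → ℝ := fun t => partialDeriv 1 φ !₂[s, t] with hζ
    have hζc : Continuous ζ' := (continuous_partialDeriv 1 hφ).comp
      (continuous_plane.comp (continuous_const.prodMk continuous_id))
    have hζd : ∀ t, HasDerivAt (fun r : ℝ => φ !₂[s, r]) (ζ' t) t :=
      fun t => hasDerivAt_plane_one hφ s t
    have hpt : ∀ t, tentField l w L !₂[s, t] 0 0 * ζ' t
        = tentSlope l s * (Set.Ioo (-k) k).indicator ζ' t := by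
      intro t
      have hm := tentHeight_pos_iff_slice_symm hl0 hl1 hw hL s t
      rw [← hk] at hm
      rw [tentField_zero_zero]
      by_cases h : t ∈ Set.Ioo (-k) k
      · rw [if_pos (hm.2 h), Set.indicator_of_mem h]
        rfl
      · rw [if_neg (fun hx => h (hm.1 hx)), Set.indicator_of_notMem h, zero_mul, mul_zero]
    change |∫ t : ℝ, tentField l w L !₂[s, t] 0 0 * ζ' t| ≤ 2
    simp_rw [hpt]
    rw [integral_const_mul, integral_indicator measurableSet_Ioo, abs_mul]
    have b := abs_setIntegral_Ioo_deriv_le hζd hζc (fun s => hb _) (-k) k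
    calc _ ≤ 1 * (2 : ℝ) := mul_le_mul (abs_tentSlope_le hl0 hl1 s) b (abs_nonneg _) zero_le_one
      _ = 2 := one_mul 2
  · have hz : ∀ t : ℝ, tentField l w L !₂[s, t] 0 0 = 0 := fun t => by
      rw [tentField_zero_zero, if_neg]
      exact fun hx => hs (mem_Ioo_of_tentHeight_pos hl0 hl1 hw hL hx).1
    simp [Set.indicator_of_notMem hs, hz]

lemma totalVariation_tentField_le (hl0 : 0 < l) (hl1 : l < 1) (hw : 0 < w) (hwL : w ≤ L) :
    totalVariation (tentField l w L) ≤ ENNReal.ofReal (8 * L) := by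
  have hL : 0 < L := hw.trans_le hwL
  refine iSup₂_le fun φ hφ => ENNReal.ofReal_le_ofReal ?_
  have hb : ∀ k x, |φ 0 0 k x| ≤ 1 := fun k x => by
    rw [← sq_le_one_iff_abs_le_one]
    refine le_trans ?_ (hφ.2.2 x)
    refine le_trans ?_ (Finset.single_le_sum (f := fun i => ∑ j, ∑ k, φ i j k x ^ 2)
      (fun i _ => Finset.sum_nonneg fun j _ => Finset.sum_nonneg fun k _ => sq_nonneg _)
      (Finset.mem_univ 0))
    refine le_trans ?_ (Finset.single_le_sum (f := fun j => ∑ k, φ 0 j k x ^ 2)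
      (fun j _ => Finset.sum_nonneg fun k _ => sq_nonneg _) (Finset.mem_univ 0))
    exact Finset.single_le_sum (f := fun k => φ 0 0 k x ^ 2) (fun k _ => sq_nonneg _)
      (Finset.mem_univ k)
  have hpt : ∀ x, ∑ i, ∑ j, ∑ k, tentField l w L x i j * partialDeriv k (φ i j k) x
      = tentField l w L x 0 0 * partialDeriv 0 (φ 0 0 0) x
        + tentField l w L x 0 0 * partialDeriv 1 (φ 0 0 1) x := by
    intro x
    simp [Fin.sum_univ_two, tentField_apply_of_ne]
  have hi0 := integrable_tentField_mul (w := w) (L := L) hl0 hl1 (hφ.1 0 0 0) (hφ.2.1 0 0 0) 0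
  have hi1 := integrable_tentField_mul (w := w) (L := L) hl0 hl1 (hφ.1 0 0 1) (hφ.2.1 0 0 1) 1
  simp_rw [hpt]
  -- Each derivative is integrated first along its own direction; the outer integrals give `4 L + 2
  -- w ≤ 8 L`.
  rw [integral_add hi0 hi1, integral_plane_symm hi0, integral_plane hi1]
  have hind : ∀ a b : ℝ, Integrable ((Set.Ioo a b).indicator fun _ => (2 : ℝ)) := fun a b =>
    (integrableOn_const (by simp)).integrable_indicator measurableSet_Ioo
  have b0 := norm_integral_le_of_norm_le
    (f := fun t : ℝ => ∫ s : ℝ, tentField l w L !₂[s, t] 0 0 * partialDeriv 0 (φ 0 0 0) !₂[s, t])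
    (hind (-L) L) (Filter.Eventually.of_forall
    (abs_integral_tentField_slice_zero_le hl0 hl1 hw hL (hφ.1 0 0 0) (hb 0)))
  have b1 := norm_integral_le_of_norm_le
    (f := fun s : ℝ => ∫ t : ℝ, tentField l w L !₂[s, t] 0 0 * partialDeriv 1 (φ 0 0 1) !₂[s, t])
    (hind (-(l * w)) ((1 - l) * w))
    (Filter.Eventually.of_forall
      (abs_integral_tentField_slice_one_le hl0 hl1 hw hL (hφ.1 0 0 1) (hb 1)))
  have v0 : ∫ t, (Set.Ioo (-L) L).indicator (fun _ => (2 : ℝ)) t = 4 * L := by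
    rw [integral_indicator measurableSet_Ioo, setIntegral_const, Real.volume_real_Ioo_of_le
      (by linarith), smul_eq_mul]
    ring
  have v1 : ∫ t, (Set.Ioo (-(l * w)) ((1 - l) * w)).indicator (fun _ => (2 : ℝ)) t = 2 * w := by
    rw [integral_indicator measurableSet_Ioo, setIntegral_const, Real.volume_real_Ioo_of_le
      (by nlinarith), smul_eq_mul]
    ring
  rw [v0, Real.norm_eq_abs, abs_le] at b0
  rw [v1, Real.norm_eq_abs, abs_le] at b1
  linarith [b0.2, b1.2]

lemma isPhaseField_tentField (hl0 : 0 < l) (hl1 : l < 1) (hw : 0 < w) (hwL : w ≤ L) :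
    IsPhaseField (twoWells l) (tentField l w L) where
  integrable := integrable_tentField hl0 hl1 hw (hw.trans_le hwL)
  totalVariation_lt_top :=
    (totalVariation_tentField_le hl0 hl1 hw hwL).trans_lt ENNReal.ofReal_lt_top
  mem_wells := Filter.Eventually.of_forall fun x => by
    unfold tentField tentSlope twoWells
    split_ifs <;> simp

end Tent

/-! ### The tent displacement and its elastic energy. -/

section TentDisplacement

variable {l w L : ℝ}

/-- The displacement associated with the diamond-shaped inclusion. -/
noncomputable def tent (l w L : ℝ) (x : Space 2) : ℝ := max (tentHeight l w L x) 0

/-- Lipschitz regularity is what permits integration by parts with line derivatives in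
`isWeakGradient_tent`. -/
lemma exists_lipschitzWith_tent (l w L : ℝ) : ∃ C, LipschitzWith C (tent l w L) := by
  let P : Fin 2 → Space 2 →L[ℝ] ℝ := fun i => EuclideanSpace.proj i
  have h1 : LipschitzWith _ fun x : Space 2 => l * (1 - l) * (w / L) * ‖P 1 x‖ :=
    (lipschitzWith_smul (l * (1 - l) * (w / L))).comp (lipschitzWith_one_norm.comp (P 1).lipschitz)
  have h2 : LipschitzWith _ fun x : Space 2 => max (-(1 - l) * x 0) (l * x 0) :=
    ((-(1 - l)) • P 0).lipschitz.max (l • P 0).lipschitz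
  have h3 := (((LipschitzWith.const (l * (1 - l) * w)).sub h1).sub h2).max_const 0
  have e : tent l w L = fun x => max (l * (1 - l) * w - l * (1 - l) * (w / L) * ‖P 1 x‖
      - max (-(1 - l) * x 0) (l * x 0)) 0 := by
    funext x
    have hP : ‖P 1 x‖ = |x 1| := rfl
    rw [tent, tentHeight, hP, mul_sub, mul_assoc (l * (1 - l)) (w / L)]
  exact ⟨_, e ▸ h3⟩

lemma tent_eq_zero_of_nonpos {x : Space 2} (h : tentHeight l w L x ≤ 0) : tent l w L x = 0 :=
  max_eq_right h

lemma hasCompactSupport_tent (hl0 : 0 < l) (hl1 : l < 1) (hw : 0 < w) (hL : 0 < L) :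
    HasCompactSupport (tent l w L) := by
  refine HasCompactSupport.intro
    (((isCompact_Icc (a := -(l * w)) (b := (1 - l) * w)).prod
      (isCompact_Icc (a := -L) (b := L))).image continuous_plane) fun x hx => ?_
  refine tent_eq_zero_of_nonpos (not_lt.1 fun h => hx ?_)
  have hm := mem_Ioo_of_tentHeight_pos hl0 hl1 hw hL h
  refine ⟨(x 0, x 1), ⟨Set.Ioo_subset_Icc_self hm.1, Set.Ioo_subset_Icc_self hm.2⟩, ?_⟩
  ext i
  fin_cases i <;> simp

lemma hasDerivAt_tentHeight_zero {x : Space 2} (hx : x 0 ≠ 0) :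
    HasDerivAt (fun t : ℝ => tentHeight l w L (x + t • EuclideanSpace.single 0 1))
      (tentSlope l (x 0)) 0 := by
  have e : ∀ t : ℝ, tentHeight l w L (x + t • EuclideanSpace.single 0 1)
      = l * (1 - l) * (w - w / L * |x 1|) - max (-(1 - l) * (x 0 + t)) (l * (x 0 + t)) := by
    intro t
    simp [tentHeight]
  have hid : HasDerivAt (fun t : ℝ => x 0 + t) 1 0 := (hasDerivAt_id 0).const_add _
  have hcont : Continuous fun t : ℝ => x 0 + t := by fun_prop
  simp_rw [e]
  rcases lt_or_gt_of_ne hx with h | h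
  · have hd := (hid.const_mul (-(1 - l))).const_sub (l * (1 - l) * (w - w / L * |x 1|))
    rw [tentSlope, if_pos h]
    refine (hd.congr_deriv (by ring)).congr_of_eventuallyEq ?_
    filter_upwards [hcont.continuousAt.eventually (gt_mem_nhds (by simpa using h))] with t ht
    rw [max_eq_left (by nlinarith)]
  · have hd := (hid.const_mul l).const_sub (l * (1 - l) * (w - w / L * |x 1|))
    rw [tentSlope, if_neg (not_lt.2 h.le)]
    refine (hd.congr_deriv (by ring)).congr_of_eventuallyEq ?_
    filter_upwards [hcont.continuousAt.eventually (lt_mem_nhds (by simpa using h))] with t ht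
    rw [max_eq_right (by nlinarith)]

lemma hasDerivAt_tentHeight_one {x : Space 2} (hx : x 1 ≠ 0) :
    HasDerivAt (fun t : ℝ => tentHeight l w L (x + t • EuclideanSpace.single 1 1))
      (-(l * (1 - l) * (w / L * SignType.sign (x 1)))) 0 := by
  have e : ∀ t : ℝ, tentHeight l w L (x + t • EuclideanSpace.single 1 1)
      = l * (1 - l) * (w - w / L * |x 1 + t|) - max (-(1 - l) * x 0) (l * x 0) := by
    intro t
    simp [tentHeight]
  simp_rw [e]
  have hid : HasDerivAt (fun t : ℝ => x 1 + t) 1 0 := (hasDerivAt_id 0).const_add _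
  have habs : HasDerivAt (fun t : ℝ => |x 1 + t|) (SignType.sign (x 1)) 0 := by
    have h := (hasDerivAt_abs (by simpa using hx : x 1 + (0 : ℝ) ≠ 0)).comp 0 hid
    rwa [add_zero, mul_one] at h
  exact ((((habs.const_mul (w / L)).const_sub w).const_mul (l * (1 - l))).sub_const _).congr_deriv
    (by ring)

lemma lineDeriv_tent_of_neg {x : Space 2} (h : tentHeight l w L x < 0) (v : Space 2) :
    lineDeriv ℝ (tent l w L) x v = 0 := by
  have : tent l w L =ᶠ[nhds x] fun _ => 0 := by
    filter_upwards [(continuous_tentHeight l w L).continuousAt.eventually (gt_mem_nhds h)] with y hy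
    exact tent_eq_zero_of_nonpos hy.le
  rw [this.lineDeriv_eq]
  simp [lineDeriv]

lemma lineDeriv_tent_of_pos {x : Space 2} (h : 0 < tentHeight l w L x) {v : Space 2} {d : ℝ}
    (hd : HasDerivAt (fun t : ℝ => tentHeight l w L (x + t • v)) d 0) :
    lineDeriv ℝ (tent l w L) x v = d := by
  have : tent l w L =ᶠ[nhds x] tentHeight l w L := by
    filter_upwards [(continuous_tentHeight l w L).continuousAt.eventually (lt_mem_nhds h)] with y hy
    exact max_eq_left hy.le
  rw [this.lineDeriv_eq]
  exact hd.deriv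

lemma ae_coord_ne_zero (i : Fin 2) : ∀ᵐ x : Space 2, x i ≠ 0 := by
  have hm : MeasurableSet {x : Space 2 | x i ≠ 0} :=
    (isOpen_ne_fun (by fun_prop) continuous_const).measurableSet
  have hne : ∀ᵐ s : ℝ, s ≠ 0 := Measure.ae_ne volume 0
  refine ae_plane hm ?_
  fin_cases i
  · filter_upwards [hne] with s hs
    exact Filter.Eventually.of_forall fun t => hs
  · exact Filter.Eventually.of_forall fun s => hne

/-- Every vertical line meets the zero set in at most two points `t = ±k`. -/
lemma ae_tentHeight_ne_zero (hl0 : 0 < l) (hl1 : l < 1) (hw : 0 < w) (hL : 0 < L) :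
    ∀ᵐ x : Space 2, tentHeight l w L x ≠ 0 := by
  have hm : MeasurableSet {x : Space 2 | tentHeight l w L x ≠ 0} :=
    (isOpen_ne_fun (continuous_tentHeight l w L) continuous_const).measurableSet
  refine ae_plane hm (Filter.Eventually.of_forall fun s => ?_)
  set k : ℝ := L / w * (w - max (-(1 - l) * s) (l * s) / (l * (1 - l))) with hk
  filter_upwards [Measure.ae_ne volume k, Measure.ae_ne volume (-k)] with t h1 h2 h0
  have hc : 0 < 1 - l := by linarith
  have hkt : |t| = k := by
    simp only [tentHeight] at h0
    simp only [Matrix.cons_val_zero, Matrix.cons_val_one] at h0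
    rw [hk, ← sub_eq_zero.1 h0]
    field_simp
    ring
  rcases abs_choice t with h | h
  · exact h1 (h.symm.trans hkt)
  · exact h2 (by linarith)

/-- The weak gradient of the displacement. -/
noncomputable def tentGrad (l w L : ℝ) (x : Space 2) : Matrix (Fin 2) (Fin 2) ℝ :=
  fun i j => if i = 0 then lineDeriv ℝ (tent l w L) x (EuclideanSpace.single j 1) else 0

/-- Off the null set of kinks the gradient can be read off the affine pieces: the longitudinal slope
matches the well exactly, and the whole elastic error is the transversal slope, of size `l (1 - l) w
/ L` inside the diamond. -/
lemma ae_tentGrad (hl0 : 0 < l) (hl1 : l < 1) (hw : 0 < w) (hL : 0 < L) :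
    ∀ᵐ x : Space 2, tentGrad l w L x 0 0 = tentField l w L x 0 0 ∧
      |tentGrad l w L x 0 1| ≤ {x | 0 < tentHeight l w L x}.indicator (fun _ => w / L) x := by
  filter_upwards [ae_coord_ne_zero 0, ae_coord_ne_zero 1,
    ae_tentHeight_ne_zero hl0 hl1 hw hL] with x h0 h1 hne
  simp only [tentGrad, if_true, tentField_zero_zero]
  rcases lt_or_gt_of_ne hne with h | h
  · rw [if_neg (not_lt.2 h.le), lineDeriv_tent_of_neg h, lineDeriv_tent_of_neg h,
      Set.indicator_of_notMem (show x ∉ {x | 0 < tentHeight l w L x} from not_lt.2 h.le)]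
    simp
  · rw [if_pos h, lineDeriv_tent_of_pos h (hasDerivAt_tentHeight_zero h0),
      lineDeriv_tent_of_pos h (hasDerivAt_tentHeight_one h1),
      Set.indicator_of_mem (show x ∈ {x | 0 < tentHeight l w L x} from h)]
    refine ⟨rfl, ?_⟩
    have hs : |((SignType.sign (x 1) : SignType) : ℝ)| = 1 := by
      rcases lt_or_gt_of_ne h1 with h | h
      · simp [sign_neg h]
      · simp [sign_pos h]
    have hl : 0 ≤ l * (1 - l) := mul_nonneg hl0.le (by linarith)
    have hwL : 0 ≤ w / L := by positivity
    rw [abs_neg, abs_mul, abs_mul (w / L), hs, abs_of_nonneg hl, abs_of_nonneg hwL, mul_one]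
    exact mul_le_of_le_one_left hwL (by nlinarith)

lemma memLp_tentGrad (hl0 : 0 < l) (hl1 : l < 1) (hw : 0 < w) (hL : 0 < L) (i j : Fin 2) :
    MemLp (fun x => tentGrad l w L x i j) 2 volume := by
  by_cases hi : i = 0
  · subst hi
    obtain ⟨C, hC⟩ := exists_lipschitzWith_tent l w L
    have hm : AEStronglyMeasurable (fun x => tentGrad l w L x 0 j) volume :=
      (measurable_lineDeriv hC.continuous).aestronglyMeasurable
    have hbound : ∀ᵐ x : Space 2, ‖tentGrad l w L x 0 j ^ 2‖
        ≤ {x | 0 < tentHeight l w L x}.indicator (fun _ => 1 + (w / L) ^ 2) x := by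
      filter_upwards [ae_tentGrad hl0 hl1 hw hL] with x hx
      rw [Real.norm_of_nonneg (sq_nonneg _)]
      have hn : 0 ≤ (w / L) ^ 2 := sq_nonneg _
      by_cases h : 0 < tentHeight l w L x
      · rw [Set.indicator_of_mem (by exact h)] at hx ⊢
        fin_cases j
        · have h2 : tentGrad l w L x 0 0 ^ 2 ≤ 1 := by
            rw [hx.1, sq_le_one_iff_abs_le_one]
            exact abs_tentField_zero_zero_le hl0 hl1 x
          exact h2.trans (by linarith)
        · have h2 := pow_le_pow_left₀ (abs_nonneg _) hx.2 2
          rw [sq_abs] at h2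
          exact h2.trans (by linarith)
      · rw [Set.indicator_of_notMem (by exact h)] at hx ⊢
        fin_cases j
        · have h2 : tentGrad l w L x 0 0 = 0 := by
            rw [hx.1, tentField_zero_zero, if_neg h]
          exact (by rw [h2]; simp : tentGrad l w L x 0 0 ^ 2 ≤ 0)
        · have h2 : tentGrad l w L x 0 1 = 0 := abs_nonpos_iff.1 hx.2
          exact (by rw [h2]; simp : tentGrad l w L x 0 1 ^ 2 ≤ 0)
    exact (memLp_two_iff_integrable_sq hm).2
      ((integrable_indicator_tent hl0 hl1 hw hL _).mono' (hm.pow 2) hbound)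
  · simp only [tentGrad, if_neg hi]
    exact MemLp.zero'

lemma isWeakGradient_tent (l w L : ℝ) :
    IsWeakGradient (fun x => EuclideanSpace.single 0 (tent l w L x)) (tentGrad l w L) := by
  intro i j φ hφ hc
  by_cases hi : i = 0
  · subst hi
    obtain ⟨C, hC⟩ := exists_lipschitzWith_tent l w L
    have hφ1 : ContDiff ℝ 1 φ := hφ.of_le (by simp)
    obtain ⟨D, hD⟩ := hφ1.lipschitzWith_of_hasCompactSupport hc one_ne_zero
    have h := hC.integral_lineDeriv_mul_eq (μ := volume) hD hc (EuclideanSpace.single j 1)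
    have h2 : ∀ x, lineDeriv ℝ φ x (-EuclideanSpace.single j 1) = -partialDeriv j φ x := by
      intro x
      rw [((hφ1.differentiable one_ne_zero) x).lineDeriv_eq_fderiv, map_neg, partialDeriv]
    simp_rw [h2, neg_mul] at h
    rw [integral_neg] at h
    simp only [tentGrad, if_true, PiLp.single_apply]
    rw [h, neg_neg]
    simp_rw [mul_comm]
  · simp [tentGrad, hi]

/-- The displacement of the diamond-shaped inclusion as a Sobolev field. -/
noncomputable def tentSobolev (hl0 : 0 < l) (hl1 : l < 1) (hw : 0 < w) (hL : 0 < L) :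
    SobolevH1 2 where
  toFun x := EuclideanSpace.single 0 (tent l w L x)
  grad := tentGrad l w L
  memLp_toFun := by
    obtain ⟨C, hC⟩ := exists_lipschitzWith_tent l w L
    have hc : Continuous fun x => (EuclideanSpace.single 0 (tent l w L x) : Space 2) :=
      (LipschitzWith.of_dist_le_mul (K := 1) (f := fun a : ℝ =>
        (EuclideanSpace.single 0 a : Space 2)) fun a b => by simp).continuous.comp hC.continuous
    refine hc.memLp_of_hasCompactSupport ?_
    exact (hasCompactSupport_tent hl0 hl1 hw hL).comp_left
      (g := fun a : ℝ => (EuclideanSpace.single 0 a : Space 2)) (by simp)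
  memLp_grad := memLp_tentGrad hl0 hl1 hw hL
  isWeakGradient := isWeakGradient_tent l w L

lemma elasticEnergy_tent_le (hl0 : 0 < l) (hl1 : l < 1) (hw : 0 < w) (hL : 0 < L) :
    elasticEnergy (tentSobolev hl0 hl1 hw hL) (tentField l w L)
      ≤ ENNReal.ofReal ((w / L) ^ 2 * (w * L)) := by
  have h : elasticEnergy (tentSobolev hl0 hl1 hw hL) (tentField l w L)
      ≤ ∫⁻ x, {x | 0 < tentHeight l w L x}.indicator
        (fun _ => ENNReal.ofReal ((w / L) ^ 2)) x := by
    refine lintegral_mono_ae ?_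
    filter_upwards [ae_tentGrad hl0 hl1 hw hL] with x hx
    have e : ∑ i, ∑ j, ((tentSobolev hl0 hl1 hw hL).grad x i j - tentField l w L x i j) ^ 2
        = tentGrad l w L x 0 1 ^ 2 := by
      have e1 : ∀ j, tentGrad l w L x 1 j = 0 := fun j => by simp [tentGrad]
      change ∑ i, ∑ j, (tentGrad l w L x i j - tentField l w L x i j) ^ 2 = _
      simp [Fin.sum_univ_two, hx.1, e1, tentField_apply_of_ne]
    rw [e]
    by_cases hpos : 0 < tentHeight l w L x
    · rw [Set.indicator_of_mem (by exact hpos)] at hx ⊢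
      refine ENNReal.ofReal_le_ofReal ?_
      rw [← sq_abs]
      exact pow_le_pow_left₀ (abs_nonneg _) hx.2 2
    · rw [Set.indicator_of_notMem (by exact hpos)] at hx ⊢
      have h2 : tentGrad l w L x 0 1 = 0 := abs_nonpos_iff.1 hx.2
      simp [h2]
  refine h.trans_eq ?_
  rw [lintegral_indicator_const (measurableSet_tent l w L), volume_tent hl0 hl1 hw hL,
    ← ENNReal.ofReal_mul (sq_nonneg _)]

lemma minimalEnergy_le_of_tent {ε : ℝ} (hl0 : 0 < l) (hl1 : l < 1) (hw : 0 < w) (hwL : w ≤ L)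
    (hε : 0 < ε) :
    minimalEnergy (twoWells l) ε (w * L)
      ≤ ENNReal.ofReal ((w / L) ^ 2 * (w * L) + ε * (8 * L)) := by
  have hL : 0 < L := hw.trans_le hwL
  have hvol : volume {x | tentField l w L x ≠ 0} = ENNReal.ofReal (w * L) := by
    simp_rw [tentField_ne_zero_iff hl0 hl1]
    exact volume_tent hl0 hl1 hw hL
  refine iInf_le_of_le (tentField l w L) (iInf_le_of_le (isPhaseField_tentField hl0 hl1 hw hwL)
    (iInf_le_of_le hvol ?_))
  rw [ENNReal.ofReal_add (by positivity) (by positivity), ENNReal.ofReal_mul hε.le, totalEnergy]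
  gcongr
  · exact (iInf_le _ (tentSobolev hl0 hl1 hw hL)).trans (elasticEnergy_tent_le hl0 hl1 hw hL)
  · exact totalVariation_tentField_le hl0 hl1 hw hwL

end TentDisplacement

/-! ### Choice of the diamond and conclusion. -/

/-- The upper scaling bound. -/
theorem minimalEnergy_le_scalingLaw {l V ε : ℝ} (hl0 : 0 < l) (hl1 : l < 1) (hV : 0 < V)
    (hε : 0 < ε) :
    minimalEnergy (twoWells l) ε V ≤ ENNReal.ofReal (9 * scalingLaw ε V) := by
  unfold scalingLaw
  split_ifs with hVε
  · obtain ⟨s, hs, rfl⟩ : ∃ s : ℝ, 0 < s ∧ V = s ^ 2 :=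
      ⟨√V, Real.sqrt_pos.2 hV, (Real.sq_sqrt hV.le).symm⟩
    have hsε : s ≤ ε := le_of_pow_le_pow_left₀ two_ne_zero hε.le hVε
    -- With `w = L = s` the energy is at most `s² + 8 ε s`, and `s ≤ ε` gives the constant 9.
    have h := minimalEnergy_le_of_tent (l := l) hl0 hl1 hs le_rfl hε
    rw [← Real.sqrt_eq_rpow, Real.sqrt_sq hs.le]
    rw [← pow_two] at h
    refine h.trans (ENNReal.ofReal_le_ofReal ?_)
    rw [div_self hs.ne']
    nlinarith
  · obtain ⟨v, hv, rfl⟩ : ∃ v : ℝ, 0 < v ∧ V = v ^ 5 :=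
      ⟨V ^ (1 / 5 : ℝ), by positivity, by
        rw [← Real.rpow_natCast, ← Real.rpow_mul hV.le]; norm_num⟩
    obtain ⟨e, he, rfl⟩ : ∃ e : ℝ, 0 < e ∧ ε = e ^ 5 :=
      ⟨ε ^ (1 / 5 : ℝ), by positivity, by
        rw [← Real.rpow_natCast, ← Real.rpow_mul hε.le]; norm_num⟩
    have e1 : (e ^ 5) ^ (4 / 5 : ℝ) = e ^ 4 := by
      rw [← Real.rpow_natCast, ← Real.rpow_mul he.le, ← Real.rpow_natCast]; norm_num
    have e2 : (v ^ 5) ^ (3 / 5 : ℝ) = v ^ 3 := by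
      rw [← Real.rpow_natCast, ← Real.rpow_mul hv.le, ← Real.rpow_natCast]; norm_num
    have hev : e ^ 2 ≤ v := by
      refine le_of_pow_le_pow_left₀ (n := 5) (by norm_num) hv.le ?_
      calc (e ^ 2) ^ 5 = (e ^ 5) ^ 2 := by ring
        _ ≤ v ^ 5 := (not_le.1 hVε).le
    -- In the original variables `w = V^(2/5) ε^(1/5)` and `L = V^(3/5) ε^(-1/5)`, for which `w L =
    -- V` and `w³ / L = ε L`. The requirement `w ≤ L` amounts to `e² ≤ v`, which follows from `ε² <
    -- V`.
    have h := minimalEnergy_le_of_tent (l := l) (w := v ^ 2 * e) (L := v ^ 3 / e) hl0 hl1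
      (by positivity) (by
        rw [le_div_iff₀ he]
        calc v ^ 2 * e * e = v ^ 2 * e ^ 2 := by ring
          _ ≤ v ^ 2 * v := by gcongr
          _ = v ^ 3 := by ring) hε
    have e3 : v ^ 2 * e * (v ^ 3 / e) = v ^ 5 := by field_simp
    have e4 : (v ^ 2 * e / (v ^ 3 / e)) ^ 2 * v ^ 5 + e ^ 5 * (8 * (v ^ 3 / e))
        = 9 * (e ^ 4 * v ^ 3) := by
      field_simp
      ring
    rw [e3, e4] at h
    rwa [e1, e2]

end Nucleation

theorem theorem1p2 (l : ℝ) (hl0 : 0 < l) (hl1 : l < 1) :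
    ∃ C₁ C₂ : ℝ, 0 < C₁ ∧ C₁ < C₂ ∧ ∀ V ε : ℝ, 0 < V → 0 < ε →
      ENNReal.ofReal (C₁ * Nucleation.scalingLaw ε V)
          ≤ Nucleation.minimalEnergy (Nucleation.twoWells l) ε V ∧
        Nucleation.minimalEnergy (Nucleation.twoWells l) ε V
          ≤ ENNReal.ofReal (C₂ * Nucleation.scalingLaw ε V) := by
  have hq : 0 < min l (1 - l) := lt_min hl0 (by linarith)
  refine ⟨min l (1 - l) ^ 16 / 6144 ^ 2, 9, by positivity, ?_, fun V ε hV hε =>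
    ⟨Nucleation.scalingLaw_le_minimalEnergy hl0 hl1 hV hε,
      Nucleation.minimalEnergy_le_scalingLaw hl0 hl1 hV hε⟩⟩
  have : min l (1 - l) ^ 16 ≤ 1 := pow_le_one₀ hq.le ((min_le_left _ _).trans hl1.le)
  linarith
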